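/- Let $d\ge 0$ be an integer. Let $P_2(\mathbb R^d)$ be the set of Borel probability measures on $\mathbb R^d$ with finite second moment, and $P_2^{ac}(\mathbb R^d)$ the set of those that are absolutely continuous with respect to Lebesgue measure. Write $\mu\le_{\mathrm{cx}}\nu$ if $\int\varphi\,d\mu\le\int\varphi\,d\nu$ for every real-valued convex function $\varphi$ on $\mathbb R^d$ for which both integrals exist in the extended sense, and let $\mathcal T_2(\mu,\nu)=\inf_{\pi}\int|x-y|^2\,d\pi(x,y)$, the infimum being over the couplings $\pi$ of $\mu$ and $\nu$. For a function $\Phi:\mathbb R^d\to\mathbb R$ let $\Phi^*(y)=\sup_x\{x\cdot y-\Phi(x)\}\in(-\infty,\infty]$; we say that $\Phi^*$ is differentiable at $y$ if it is finite near $y$ and differentiable there. Let $\mu\in P_2(\mathbb R^d)$ and $\nu\in P_2^{ac}(\mathbb R^d)$. Then there is exactly one minimizer $\bar\mu$ of $\eta\mapsto\mathcal T_2(\mu,\eta)$ over $\{\eta\in P_2(\mathbb R^d):\eta\le_{\mathrm{cx}}\nu\}$ (the backward projection of $\mu$), and exactly one minimizer $\bar\nu$ of $\xi\mapsto\mathcal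 T_2(\xi,\nu)$ over $\{\xi\in P_2(\mathbb R^d):\mu\le_{\mathrm{cx}}\xi\}$ (the forward projection of $\nu$). There is a convex function $\Phi:\mathbb R^d\to\mathbb R$ of class $C^1$ such that $\Phi^*$ is differentiable $\nu$-almost everywhere and $$(\nabla\Phi)_\#\mu=\bar\mu,\qquad (\nabla\Phi^*)_\#\nu=\bar\nu .$$ Both maps are optimal: $\int|x-\nabla\Phi(x)|^2\,d\mu(x)=\mathcal T_2(\mu,\bar\mu)$ and $\int|\nabla\Phi^*(y)-y|^2\,d\nu(y)=\mathcal T_2(\bar\nu,\nu)$. They are inverse to each other in the following sense: for all $x$ and all $y$ at which $\Phi^*$ is differentiable, $\nabla\Phi^*(y)=x$ if and only if $\nabla\Phi(x)=y$; in particular $\nabla\Phi(\nabla\Phi^*(y))=y$ for $\nu$-a.e. $y$ and $\nabla\Phi^*(\nabla\Phi(x))=x$ for $\bar\nu$-a.e. $x$. Moreover $\bar\nu\in P_2^{ac}(\mathbb R^d)$. -/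

import Mathlib

open MeasureTheory Filter Topology
open scoped ENNReal Gradient

/-- Euclidean space `ℝ^d`. -/
abbrev Euc (d : ℕ) : Type := EuclideanSpace ℝ (Fin d)

/-- `P₂(ℝ^d)`: Borel probability measures with finite second moment. -/
def IsP2 {d : ℕ} (μ : Measure (Euc d)) : Prop :=
  IsProbabilityMeasure μ ∧ ∫⁻ x, ‖x‖ₑ ^ 2 ∂μ < ∞

/-- `P₂^{ac}(ℝ^d)`: members of `P₂(ℝ^d)` that are absolutely continuous with respect to
Lebesgue measure. -/
def IsP2ac {d : ℕ} (μ : Measure (Euc d)) : Prop :=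
  IsP2 μ ∧ μ ≪ (volume : Measure (Euc d))

/-- The integral of `φ` exists in the extended sense: `∫ φ⁺` and `∫ φ⁻` are not both infinite. -/
def ExtIntegralExists {d : ℕ} (μ : Measure (Euc d)) (φ : Euc d → ℝ) : Prop :=
  ∫⁻ x, ENNReal.ofReal (φ x) ∂μ ≠ ∞ ∨ ∫⁻ x, ENNReal.ofReal (-φ x) ∂μ ≠ ∞

/-- The integral `∫ φ⁺ - ∫ φ⁻` in `[-∞, ∞]`. -/
noncomputable def extIntegral {d : ℕ} (μ : Measure (Euc d)) (φ : Euc d → ℝ) : EReal :=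
  ((∫⁻ x, ENNReal.ofReal (φ x) ∂μ : ℝ≥0∞) : EReal) -
    ((∫⁻ x, ENNReal.ofReal (-φ x) ∂μ : ℝ≥0∞) : EReal)

/-- Convex order: `∫ φ dμ ≤ ∫ φ dν` for every real-valued convex `φ` for which both integrals
exist in the extended sense. -/
def ConvexOrder {d : ℕ} (μ ν : Measure (Euc d)) : Prop :=
  ∀ φ : Euc d → ℝ, ConvexOn ℝ Set.univ φ →
    ExtIntegralExists μ φ → ExtIntegralExists ν φ → extIntegral μ φ ≤ extIntegral ν φ

/-- The backward cone `{η ∈ P₂ : η ≤_cx ν}`. -/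
def backwardCone {d : ℕ} (ν : Measure (Euc d)) : Set (Measure (Euc d)) :=
  {η | IsP2 η ∧ ConvexOrder η ν}

/-- The forward cone `{ξ ∈ P₂ : μ ≤_cx ξ}`. -/
def forwardCone {d : ℕ} (μ : Measure (Euc d)) : Set (Measure (Euc d)) :=
  {ξ | IsP2 ξ ∧ ConvexOrder μ ξ}

/-- The couplings `Π(μ, ν)`: probability measures with marginals `μ` and `ν`. -/
def couplings {d : ℕ} (μ ν : Measure (Euc d)) : Set (Measure (Euc d × Euc d)) :=
  {π | IsProbabilityMeasure π ∧ π.map Prod.fst = μ ∧ π.map Prod.snd = ν}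

/-- The quadratic transport cost `T₂(μ, ν) = inf_{π ∈ Π(μ, ν)} ∫ |x - y|² dπ`. -/
noncomputable def transportCost {d : ℕ} (μ ν : Measure (Euc d)) : ℝ≥0∞ :=
  ⨅ π ∈ couplings μ ν, ∫⁻ p, ‖p.1 - p.2‖ₑ ^ 2 ∂π

/-- `η` is a projection of `μ` onto the backward cone with vertex `ν`. -/
def IsBackwardProjection {d : ℕ} (μ ν η : Measure (Euc d)) : Prop :=
  η ∈ backwardCone ν ∧ transportCost μ η = ⨅ η' ∈ backwardCone ν, transportCost μ η'

/-- `ξ` is a projection of `ν` onto the forward cone with vertex `μ`. -/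
def IsForwardProjection {d : ℕ} (μ ν ξ : Measure (Euc d)) : Prop :=
  ξ ∈ forwardCone μ ∧ transportCost ξ ν = ⨅ ξ' ∈ forwardCone μ, transportCost ξ' ν

/-- The Legendre-Fenchel transform `Φ*(y) = sup_x (x · y - Φ(x))`, with values in `[-∞, ∞]`. -/
noncomputable def legendre {d : ℕ} (Φ : Euc d → ℝ) (y : Euc d) : EReal :=
  ⨆ x : Euc d, ((inner ℝ x y - Φ x : ℝ) : EReal)

/-- An extended-real-valued function is differentiable at `y` if it is finite near `y` and its
real-valued version is differentiable at `y`. -/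
def ExtDifferentiableAt {d : ℕ} (f : Euc d → EReal) (y : Euc d) : Prop :=
  (∀ᶠ z in 𝓝 y, f z ≠ ⊤ ∧ f z ≠ ⊥) ∧ DifferentiableAt ℝ (fun z => (f z).toReal) y

/-- The gradient of an extended-real-valued function (meaningful where `ExtDifferentiableAt`). -/
noncomputable def extGradient {d : ℕ} (f : Euc d → EReal) (y : Euc d) : Euc d :=
  ∇ (fun z => (f z).toReal) y

/-! Both projections come from one dual problem: maximize ∫ v dμ - ∫ F dν over convex F and all v
with v x ≤ F y + |x - y|²/2. Replacing v by the infimal convolution of F with |·|²/2 makes it a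
Moreau envelope u, meaning that u and Φ = |·|²/2 - u are both convex; the best F for a given u is
`supConv u` = Φ* - |·|²/2. With q = ∇u, the map ∇Φ = id - q is 1-Lipschitz.

A maximizer exists (`exists_dual_optimizer`): after normalizing u 0 = 0 the value is coercive in |q
0|, so a maximizing sequence is locally equi-Lipschitz and has a pointwise limit, and Fatou's lemma
controls the F side.

Optimality yields the two convex orders. Moving F towards a convex φ gives (∇Φ)_#μ ≤_cx ν
(`backward_variation`); moving u towards a convex ψ gives μ ≤_cx (∇Φ*)_#ν (`forward_variation`). The
choices φ = 0 and ψ = 0 give the complementary slackness inequalities. Integrating v x ≤ F y + |x -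
y|²/2 against any admissible coupling then bounds its cost from below by ∫|q|² dμ, respectively
∫|∇Φ*(y) - y|² dν, and the two maps attain these bounds.

Uniqueness comes from the slack in that inequality. On the backward side it dominates |y - ∇Φ(x)|²/2
(`IsEnvelope.add_sq_le`). On the forward side it is the Fenchel gap of Φ, which forces x towards
∇Φ*(y) wherever Φ* is differentiable. Almost optimal couplings suffice, because only characteristic
functions are compared.

Absolute continuity of ν makes Φ* differentiable ν-a.e.: the frontier of its convex domain is null,
and Rademacher's theorem applies inside. Finally ∇Φ ∘ ∇Φ* = id ν-a.e. with ∇Φ Lipschitz, so (∇Φ*)_#ν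
does not charge null sets. -/

/-! ### Convex functions and their subgradients -/

/-- A real-valued convex function on `ℝ^d` has a subgradient at every point. -/
theorem ConvexOn.exists_subgradient {d : ℕ} {φ : Euc d → ℝ} (hφ : ConvexOn ℝ Set.univ φ)
    (x : Euc d) : ∃ a : Euc d, ∀ w, φ x + inner ℝ a (w - x) ≤ φ w := by
  have hc : Continuous φ := hφ.locallyLipschitz.continuous
  have hopen : IsOpen {p : Euc d × ℝ | p.1 ∈ Set.univ ∧ φ p.1 < p.2} := by
    simp only [Set.mem_univ, true_and]
    exact isOpen_lt (hc.comp continuous_fst) continuous_snd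
  obtain ⟨f, hf⟩ := geometric_hahn_banach_point_open hφ.convex_strict_epigraph hopen
    (x := (x, φ x)) (by simp)
  set l : Euc d →L[ℝ] ℝ := f.comp (ContinuousLinearMap.inl ℝ (Euc d) ℝ)
  set c : ℝ := f (0, 1)
  have hdec : ∀ (w : Euc d) (s : ℝ), f (w, s) = l w + s * c := by
    intro w s
    have : ((w, s) : Euc d × ℝ) = (w, 0) + s • ((0 : Euc d), (1 : ℝ)) := by simp
    rw [this, map_add, map_smul]
    simp [l, c]
  have hpos : 0 < c := by
    have := hf (x, φ x + 1) (by simp)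
    rw [hdec, hdec] at this
    linarith
  refine ⟨-(c⁻¹ • (InnerProductSpace.toDual ℝ (Euc d)).symm l), fun w => ?_⟩
  rw [inner_neg_left, real_inner_smul_left, InnerProductSpace.toDual_symm_apply, map_sub]
  have key : l x + φ x * c ≤ l w + φ w * c := by
    refine le_of_forall_pos_le_add fun ε hε => ?_
    have := hf (w, φ w + ε / c) (by simp; positivity)
    rw [hdec, hdec, add_mul, div_mul_cancel₀ _ hpos.ne'] at this
    linarith
  have : (φ x - φ w) * c ≤ l w - l x := by linarith
  rw [← le_div_iff₀ hpos, div_eq_inv_mul] at this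
  linarith

theorem convexOn_of_subgradients {d : ℕ} {φ : Euc d → ℝ} {a : Euc d → Euc d}
    (h : ∀ x w, φ x + inner ℝ (a x) (w - x) ≤ φ w) : ConvexOn ℝ Set.univ φ := by
  refine ⟨convex_univ, fun x _ y _ s t hs ht hst => ?_⟩
  set z := s • x + t • y
  have h1 := mul_le_mul_of_nonneg_left (h z x) hs
  have h2 := mul_le_mul_of_nonneg_left (h z y) ht
  have h3 : s * inner ℝ (a z) (x - z) + t * inner ℝ (a z) (y - z) = 0 := by
    rw [← real_inner_smul_right, ← real_inner_smul_right, ← inner_add_right]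
    have : s • (x - z) + t • (y - z) = 0 := by
      rw [smul_sub, smul_sub, sub_add_sub_comm, ← add_smul, hst, one_smul, sub_self]
    rw [this, inner_zero_right]
  have h4 : s * φ z + t * φ z = φ z := by rw [← add_mul, hst, one_mul]
  simp only [smul_eq_mul]
  linarith

/-- `u` is a Moreau envelope with gradient `q`: both `u` and `‖·‖²/2 - u` lie above their
tangents. -/
structure IsEnvelope {d : ℕ} (u : Euc d → ℝ) (q : Euc d → Euc d) : Prop where
  lower : ∀ x w, u x + inner ℝ (q x) (w - x) ≤ u w
  upper : ∀ x w, u w ≤ u x + inner ℝ (q x) (w - x) + ‖w - x‖ ^ 2 / 2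

/-- The two functions add up to ‖·‖²/2, which is differentiable, so their subgradients at x must add
up to x: testing both inequalities at x + e, with e = p x + q x - x, gives ‖e‖² ≤ ‖e‖²/2. The
subgradient inequality of the complement then turns into the upper bound on u. -/
theorem exists_isEnvelope {d : ℕ} {u : Euc d → ℝ} (h₁ : ConvexOn ℝ Set.univ u)
    (h₂ : ConvexOn ℝ Set.univ fun x => ‖x‖ ^ 2 / 2 - u x) : ∃ q, IsEnvelope u q := by
  choose q hq using h₁.exists_subgradient
  choose p hp using h₂.exists_subgradient
  have hpq : ∀ x, p x = x - q x := by
    intro x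
    set e := p x + q x - x
    have h := add_le_add (hq x (x + e)) (hp x (x + e))
    have h' : inner ℝ (p x) e + inner ℝ (q x) e - inner ℝ x e = ‖e‖ ^ 2 := by
      rw [← inner_add_left, ← inner_sub_left, real_inner_self_eq_norm_sq]
    rw [add_sub_cancel_left, norm_add_sq_real] at h
    have : ‖e‖ ^ 2 ≤ 0 := by nlinarith
    have he : e = 0 := by simpa using le_antisymm this (sq_nonneg _)
    rw [eq_sub_iff_add_eq, ← sub_eq_zero]
    exact he
  refine ⟨q, hq, fun x w => ?_⟩
  have h := hp x w
  rw [hpq, inner_sub_left] at h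
  have e1 : ‖w‖ ^ 2 = ‖x‖ ^ 2 + 2 * inner ℝ x (w - x) + ‖w - x‖ ^ 2 := by
    rw [← norm_add_sq_real, add_sub_cancel]
  simp only [e1] at h
  linarith

/-! ### Regularity and growth of Moreau envelopes -/

namespace IsEnvelope

variable {d : ℕ} {u : Euc d → ℝ} {q : Euc d → Euc d}

theorem convexOn (h : IsEnvelope u q) : ConvexOn ℝ Set.univ u :=
  convexOn_of_subgradients h.lower

theorem compl_lower (h : IsEnvelope u q) (x w : Euc d) :
    (‖x‖ ^ 2 / 2 - u x) + inner ℝ (x - q x) (w - x) ≤ ‖w‖ ^ 2 / 2 - u w := by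
  have e1 : ‖w‖ ^ 2 = ‖x‖ ^ 2 + 2 * inner ℝ x (w - x) + ‖w - x‖ ^ 2 := by
    rw [← norm_add_sq_real, add_sub_cancel]
  rw [inner_sub_left, e1]
  linarith [h.upper x w]

theorem compl_convexOn (h : IsEnvelope u q) :
    ConvexOn ℝ Set.univ fun x => ‖x‖ ^ 2 / 2 - u x :=
  convexOn_of_subgradients (a := fun x => x - q x) h.compl_lower

theorem continuous (h : IsEnvelope u q) : Continuous u :=
  h.convexOn.locallyLipschitz.continuous

/-- Firm nonexpansiveness of the gradient, by the Baillon–Haddad argument. It makes both q and id -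
q 1-Lipschitz. -/
theorem sq_norm_sub_le_inner (h : IsEnvelope u q) (x y : Euc d) :
    ‖q x - q y‖ ^ 2 ≤ inner ℝ (q x - q y) (x - y) := by
  -- The tangent at b lies below the paraboloid at a; the displacement q b - q a from a makes this
  -- comparison sharpest.
  have key : ∀ a b, u b + inner ℝ (q b) (a - b) + ‖q b - q a‖ ^ 2 / 2 ≤ u a := by
    intro a b
    have h1 := h.lower b (a + (q b - q a))
    have h2 := h.upper a (a + (q b - q a))
    rw [add_sub_cancel_left] at h2
    have e1 : inner ℝ (q b) (a + (q b - q a) - b)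
        = inner ℝ (q b) (a - b) + inner ℝ (q b) (q b - q a) := by
      rw [← inner_add_right]; congr 1; abel
    have e2 : inner ℝ (q b) (q b - q a) - inner ℝ (q a) (q b - q a) = ‖q b - q a‖ ^ 2 := by
      rw [← inner_sub_left, real_inner_self_eq_norm_sq]
    linarith
  have h1 := key x y
  have h2 := key y x
  rw [norm_sub_rev] at h1
  have e : inner ℝ (q x - q y) (x - y) = - inner ℝ (q x) (y - x) - inner ℝ (q y) (x - y) := by
    rw [inner_sub_left, ← neg_sub x y, inner_neg_right, neg_neg]
  linarith

theorem lipschitzWith (h : IsEnvelope u q) : LipschitzWith 1 q := by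
  refine LipschitzWith.of_dist_le_mul fun x y => ?_
  have h1 := h.sq_norm_sub_le_inner x y
  have h2 := real_inner_le_norm (q x - q y) (x - y)
  rw [dist_eq_norm, dist_eq_norm, NNReal.coe_one, one_mul]
  by_contra! hlt
  nlinarith [norm_nonneg (q x - q y), norm_nonneg (x - y)]

theorem lipschitzWith_compl (h : IsEnvelope u q) : LipschitzWith 1 fun x => x - q x := by
  refine LipschitzWith.of_dist_le_mul fun x y => ?_
  have h1 := h.sq_norm_sub_le_inner x y
  rw [dist_eq_norm, dist_eq_norm, NNReal.coe_one, one_mul, sub_sub_sub_comm]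
  have h2 := norm_sub_sq_real (x - y) (q x - q y)
  rw [real_inner_comm] at h2
  refine le_of_sq_le_sq ?_ (norm_nonneg _)
  nlinarith [sq_nonneg ‖q x - q y‖]

theorem norm_le (h : IsEnvelope u q) (x : Euc d) : ‖q x‖ ≤ ‖q 0‖ + ‖x‖ := by
  have := h.lipschitzWith.dist_le_mul x 0
  rw [dist_eq_norm, dist_eq_norm, NNReal.coe_one, one_mul, sub_zero] at this
  have h2 := norm_le_norm_add_norm_sub' (q x) (q 0)
  linarith

theorem add_const (h : IsEnvelope u q) (c : ℝ) : IsEnvelope (fun x => u x + c) q :=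
  ⟨fun x w => by linarith [h.lower x w], fun x w => by linarith [h.upper x w]⟩

theorem abs_sub_le (h : IsEnvelope u q) (x y : Euc d) :
    |u x - u y| ≤ (‖q 0‖ + ‖x‖ + ‖y‖) * ‖x - y‖ := by
  have h1 := h.lower x y
  have h2 := h.lower y x
  have h3 := abs_le.1 (abs_real_inner_le_norm (q x) (y - x))
  have h4 := abs_le.1 (abs_real_inner_le_norm (q y) (x - y))
  rw [norm_sub_rev] at h3
  have h5 := mul_le_mul_of_nonneg_right (h.norm_le x) (norm_nonneg (x - y))
  have h6 := mul_le_mul_of_nonneg_right (h.norm_le y) (norm_nonneg (x - y))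
  have h7 := mul_nonneg (norm_nonneg x) (norm_nonneg (x - y))
  have h8 := mul_nonneg (norm_nonneg y) (norm_nonneg (x - y))
  rw [abs_le]
  constructor <;> nlinarith [h3.1, h4.1]

theorem abs_le (h : IsEnvelope u q) (x : Euc d) :
    |u x| ≤ |u 0| + ‖q 0‖ * ‖x‖ + ‖x‖ ^ 2 := by
  have h1 := h.abs_sub_le x 0
  have h2 := abs_sub_abs_le_abs_sub (u x) (u 0)
  rw [norm_zero, add_zero, sub_zero] at h1
  nlinarith

/-- The tangent bounds from both sides squeeze the first-order remainder by a multiple of ‖w - x‖².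
-/
theorem hasGradientAt (h : IsEnvelope u q) (x : Euc d) :
    HasGradientAt (fun x => ‖x‖ ^ 2 / 2 - u x) (x - q x) x := by
  rw [hasGradientAt_iff_isLittleO]
  refine Asymptotics.IsBigO.trans_isLittleO (g := fun w => ‖w - x‖ ^ 2) ?_ ?_
  · refine Asymptotics.IsBigO.of_bound 1 (Eventually.of_forall fun w => ?_)
    have h1 := h.compl_lower x w
    have h2 := h.lower x w
    have e1 : ‖w‖ ^ 2 = ‖x‖ ^ 2 + 2 * inner ℝ x (w - x) + ‖w - x‖ ^ 2 := by
      rw [← norm_add_sq_real, add_sub_cancel]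
    rw [Real.norm_eq_abs, norm_pow, norm_norm, one_mul, _root_.abs_le]
    constructor
    · nlinarith [sq_nonneg ‖w - x‖]
    · rw [inner_sub_left, e1]
      nlinarith [sq_nonneg ‖w - x‖]
  · have : Tendsto (fun w : Euc d => w - x) (𝓝 x) (𝓝 0) := by
      have h0 : Continuous fun w : Euc d => w - x := by fun_prop
      simpa using h0.tendsto x
    have h2 := (Asymptotics.isLittleO_norm_pow_id (E' := Euc d) one_lt_two).comp_tendsto this
    exact h2

theorem gradient_eq (h : IsEnvelope u q) : ∇ (fun x => ‖x‖ ^ 2 / 2 - u x) = fun x => x - q x :=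
  _root_.gradient_eq h.hasGradientAt

theorem contDiff (h : IsEnvelope u q) : ContDiff ℝ 1 fun x => ‖x‖ ^ 2 / 2 - u x := by
  rw [contDiff_one_iff_fderiv]
  refine ⟨fun x => (h.hasGradientAt x).differentiableAt, ?_⟩
  rw [← toDual_comp_gradient, h.gradient_eq]
  exact (LinearIsometryEquiv.continuous _).comp h.lipschitzWith_compl.continuous

/-- A subgradient of `‖·‖²/2 - u` at `x` equals `x - q x`. -/
theorem eq_of_compl_lower (h : IsEnvelope u q) {x y : Euc d}
    (hy : ∀ w, (‖x‖ ^ 2 / 2 - u x) + inner ℝ y (w - x) ≤ ‖w‖ ^ 2 / 2 - u w) : x - q x = y := by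
  set e := y + q x - x with he
  have h1 := add_le_add (hy (x + e)) (h.lower x (x + e))
  have h' : inner ℝ y e + inner ℝ (q x) e - inner ℝ x e = ‖e‖ ^ 2 := by
    rw [← inner_add_left, ← inner_sub_left, real_inner_self_eq_norm_sq]
  rw [add_sub_cancel_left, norm_add_sq_real] at h1
  have : ‖e‖ ^ 2 ≤ 0 := by nlinarith
  have h0 : e = 0 := by simpa using le_antisymm this (sq_nonneg _)
  rw [sub_eq_iff_eq_add, ← sub_eq_zero, ← neg_sub, ← he, h0, neg_zero]

end IsEnvelope

/-! ### Infimal convolution with the quadratic -/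

/-- The infimal convolution of a convex function with `‖·‖²/2` is a Moreau envelope. -/
theorem exists_isEnvelope_between {d : ℕ} {D : Set (Euc d)} (hD : D.Nonempty) {F v : Euc d → ℝ}
    (hF : ConvexOn ℝ D F) (hvF : ∀ x, ∀ y ∈ D, v x ≤ F y + ‖x - y‖ ^ 2 / 2) :
    ∃ u q, IsEnvelope u q ∧ (∀ x, v x ≤ u x) ∧ ∀ x, ∀ y ∈ D, u x ≤ F y + ‖x - y‖ ^ 2 / 2 := by
  have : Nonempty D := hD.to_subtype
  set u : Euc d → ℝ := fun x => ⨅ y : D, (F y + ‖x - (y : Euc d)‖ ^ 2 / 2)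
  have hbdd : ∀ x, BddBelow (Set.range fun y : D => F y + ‖x - (y : Euc d)‖ ^ 2 / 2) := fun x =>
    ⟨v x, by rintro _ ⟨y, rfl⟩; exact hvF x y y.2⟩
  have hle : ∀ x, ∀ y ∈ D, u x ≤ F y + ‖x - y‖ ^ 2 / 2 := fun x y hy => ciInf_le (hbdd x) ⟨y, hy⟩
  have hvu : ∀ x, v x ≤ u x := fun x => le_ciInf fun y => hvF x y y.2
  have hcx : ConvexOn ℝ Set.univ u := by
    refine ⟨convex_univ, fun a _ b _ s t hs ht hst => ?_⟩
    refine le_of_forall_pos_le_add fun ε hε => ?_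
    obtain ⟨y, hy⟩ := exists_lt_of_ciInf_lt (lt_add_of_pos_right (u a) hε)
    obtain ⟨z, hz⟩ := exists_lt_of_ciInf_lt (lt_add_of_pos_right (u b) hε)
    have hmem : s • (y : Euc d) + t • (z : Euc d) ∈ D := hF.1 y.2 z.2 hs ht hst
    have h1 := hle (s • a + t • b) _ hmem
    have h2 := hF.2 y.2 z.2 hs ht hst
    have h3 : ‖s • a + t • b - (s • (y : Euc d) + t • (z : Euc d))‖ ^ 2
        ≤ s * ‖a - y‖ ^ 2 + t * ‖b - z‖ ^ 2 := by
      have hsq : ConvexOn ℝ Set.univ fun x : Euc d => ‖x‖ ^ 2 :=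
        (convexOn_norm convex_univ).pow (fun x _ => norm_nonneg x) 2
      have := hsq.2 (Set.mem_univ (a - y)) (Set.mem_univ (b - z)) hs ht hst
      simp only [smul_eq_mul] at this
      rwa [smul_sub, smul_sub, sub_add_sub_comm] at this
    have h4 := mul_le_mul_of_nonneg_left hy.le hs
    have h5 := mul_le_mul_of_nonneg_left hz.le ht
    have h6 : s * ε + t * ε = ε := by rw [← add_mul, hst, one_mul]
    simp only [smul_eq_mul] at h2 ⊢
    linarith
  -- For fixed y, ‖z - y‖²/2 - ‖z‖²/2 is affine in z, so u - ‖·‖²/2 is an infimum of affine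
  -- functions.
  have hcc : ConvexOn ℝ Set.univ fun x => ‖x‖ ^ 2 / 2 - u x := by
    refine ⟨convex_univ, fun a _ b _ s t hs ht hst => ?_⟩
    simp only [smul_eq_mul]
    have hz : ∀ z y : Euc d, ‖z - y‖ ^ 2 / 2 = ‖z‖ ^ 2 / 2 - inner ℝ z y + ‖y‖ ^ 2 / 2 := by
      intro z y; rw [norm_sub_sq_real]; ring
    suffices ‖s • a + t • b‖ ^ 2 / 2 - (s * (‖a‖ ^ 2 / 2 - u a) + t * (‖b‖ ^ 2 / 2 - u b))
        ≤ u (s • a + t • b) by linarith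
    refine le_ciInf fun y => ?_
    have h1 := mul_le_mul_of_nonneg_left (hle a y y.2) hs
    have h2 := mul_le_mul_of_nonneg_left (hle b y y.2) ht
    rw [hz] at h1 h2
    rw [hz, inner_add_left, real_inner_smul_left, real_inner_smul_left]
    have ht' : t = 1 - s := by linarith
    subst ht'
    linarith
  obtain ⟨q, hq⟩ := exists_isEnvelope hcx hcc
  exact ⟨u, q, hq, hvu, hle⟩

/-! ### Supremal convolution with the quadratic -/

/-- The set where `sup_x (u x - ‖x - y‖²/2)` is finite. -/
def supDom {d : ℕ} (u : Euc d → ℝ) : Set (Euc d) :=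
  {y | legendre (fun x => ‖x‖ ^ 2 / 2 - u x) y ≠ ⊤}

/-- The supremal convolution `sup_x (u x - ‖x - y‖²/2)`, meaningful on `supDom u`. -/
noncomputable def supConv {d : ℕ} (u : Euc d → ℝ) (y : Euc d) : ℝ :=
  (legendre (fun x => ‖x‖ ^ 2 / 2 - u x) y).toReal - ‖y‖ ^ 2 / 2

section SupConv

variable {d : ℕ} {u : Euc d → ℝ} {q : Euc d → Euc d} {y : Euc d}

theorem legendre_ne_bot (Φ : Euc d → ℝ) (y : Euc d) : legendre Φ y ≠ ⊥ := by
  intro h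
  have := le_iSup (fun x : Euc d => ((inner ℝ x y - Φ x : ℝ) : EReal)) 0
  rw [legendre] at h
  rw [h, le_bot_iff] at this
  exact EReal.coe_ne_bot _ this

theorem inner_sub_eq (u : Euc d → ℝ) (x y : Euc d) :
    inner ℝ x y - (‖x‖ ^ 2 / 2 - u x) = u x - ‖x - y‖ ^ 2 / 2 + ‖y‖ ^ 2 / 2 := by
  rw [norm_sub_sq_real]; ring

theorem le_supConv (hy : y ∈ supDom u) (x : Euc d) : u x - ‖x - y‖ ^ 2 / 2 ≤ supConv u y := by
  have h1 := le_iSup (fun x : Euc d => ((inner ℝ x y - (‖x‖ ^ 2 / 2 - u x) : ℝ) : EReal)) x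
  have h2 := EReal.toReal_le_toReal h1 (EReal.coe_ne_bot _) hy
  rw [EReal.toReal_coe, inner_sub_eq] at h2
  change _ ≤ (legendre _ y).toReal at h2
  rw [supConv]
  linarith

theorem le_supConv_add (hy : y ∈ supDom u) (x : Euc d) : u x ≤ supConv u y + ‖x - y‖ ^ 2 / 2 := by
  linarith [le_supConv hy x]

theorem legendre_le_of_forall_le {c : ℝ} (h : ∀ x, u x - ‖x - y‖ ^ 2 / 2 ≤ c) :
    legendre (fun x => ‖x‖ ^ 2 / 2 - u x) y ≤ ((c + ‖y‖ ^ 2 / 2 : ℝ) : EReal) := by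
  refine iSup_le fun x => ?_
  rw [EReal.coe_le_coe_iff, inner_sub_eq]
  linarith [h x]

theorem mem_supDom_of_forall_le {c : ℝ} (h : ∀ x, u x - ‖x - y‖ ^ 2 / 2 ≤ c) : y ∈ supDom u :=
  ((legendre_le_of_forall_le h).trans_lt (EReal.coe_lt_top _)).ne

theorem supConv_le {c : ℝ} (h : ∀ x, u x - ‖x - y‖ ^ 2 / 2 ≤ c) : supConv u y ≤ c := by
  have := EReal.toReal_le_toReal (legendre_le_of_forall_le h) (legendre_ne_bot _ _)
    (EReal.coe_ne_top _)
  rw [EReal.toReal_coe] at this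
  rw [supConv]
  linarith

theorem self_le_supConv (hy : y ∈ supDom u) : u y ≤ supConv u y := by
  simpa using le_supConv hy y

theorem convexOn_supConv (hu : ConvexOn ℝ Set.univ u) : ConvexOn ℝ (supDom u) (supConv u) := by
  have key : ∀ y ∈ supDom u, ∀ z ∈ supDom u, ∀ s t : ℝ, 0 ≤ s → 0 ≤ t → s + t = 1 →
      ∀ x, u x - ‖x - (s • y + t • z)‖ ^ 2 / 2 ≤ s * supConv u y + t * supConv u z := by
    intro y hy z hz s t hs ht hst x
    -- Substituting the displacement e for x writes the supremal convolution as a supremum over e of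
    -- the convex functions y ↦ u (y + e) - ‖e‖²/2.
    set e := x - (s • y + t • z)
    have h1 := mul_le_mul_of_nonneg_left (le_supConv hy (y + e)) hs
    have h2 := mul_le_mul_of_nonneg_left (le_supConv hz (z + e)) ht
    rw [add_sub_cancel_left] at h1 h2
    have h3 := hu.2 (Set.mem_univ (y + e)) (Set.mem_univ (z + e)) hs ht hst
    have e1 : s • (y + e) + t • (z + e) = x := by
      rw [smul_add, smul_add, add_add_add_comm, ← add_smul, hst, one_smul]
      simp [e]
    rw [e1] at h3
    simp only [smul_eq_mul] at h3
    have ht' : t = 1 - s := by linarith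
    subst ht'
    linarith
  refine ⟨fun y hy z hz s t hs ht hst => mem_supDom_of_forall_le (key y hy z hz s t hs ht hst),
    fun y hy z hz s t hs ht hst => supConv_le (key y hy z hz s t hs ht hst)⟩

theorem measurable_legendre (Φ : Euc d → ℝ) : Measurable (legendre Φ) := by
  refine LowerSemicontinuous.measurable ?_
  refine lowerSemicontinuous_iSup fun x => Continuous.lowerSemicontinuous ?_
  exact continuous_coe_real_ereal.comp (by fun_prop)

theorem measurable_supConv (u : Euc d → ℝ) : Measurable (supConv u) :=
  (measurable_legendre _).ereal_toReal.sub (by fun_prop)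

/-! ### Affine minorants of the supremal convolution and the quadratic gap -/

namespace IsEnvelope

/-- The affine minorants of the supremal convolution. -/
theorem affine_le_of_forall_le (h : IsEnvelope u q) {c : ℝ} {y : Euc d}
    (hc : ∀ x, u x ≤ c + ‖x - y‖ ^ 2 / 2) (x : Euc d) :
    u x + inner ℝ (q x) (y - (x - q x)) - ‖q x‖ ^ 2 / 2 ≤ c := by
  -- The point y + q x maximizes, over z, the tangent of u at x minus ‖z - y‖²/2.
  have h1 := hc (y + q x)
  have h2 := h.lower x (y + q x)
  rw [add_sub_cancel_left] at h1
  rw [show y - (x - q x) = y + q x - x by abel]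
  linarith

/-- Together with `affine_le_of_forall_le` this exhibits the supremal convolution as the supremum of
its affine minorants indexed by x, the form in which the convex order can be applied to it. -/
theorem sub_le_affine (u : Euc d → ℝ) (q : Euc d → Euc d) (x y : Euc d) :
    u x - ‖x - y‖ ^ 2 / 2 ≤ u x + inner ℝ (q x) (y - (x - q x)) - ‖q x‖ ^ 2 / 2 := by
  have h := sq_nonneg ‖q x - (x - y)‖
  rw [norm_sub_sq_real] at h
  rw [show y - (x - q x) = q x - (x - y) by abel, inner_sub_right, real_inner_self_eq_norm_sq]
  linarith

/-- Writing x - y = q x - (y - (x - q x)) and expanding the square turns the affine minorant into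
this bound. The extra square drives the backward side: it absorbs the error of the first variation
and yields uniqueness. -/
theorem add_sq_le_of_forall_le (h : IsEnvelope u q) {c : ℝ} {y : Euc d}
    (hc : ∀ x, u x ≤ c + ‖x - y‖ ^ 2 / 2) (x : Euc d) :
    u x + ‖y - (x - q x)‖ ^ 2 / 2 ≤ c + ‖x - y‖ ^ 2 / 2 := by
  have h1 := h.affine_le_of_forall_le hc x
  have e : x - y = q x - (y - (x - q x)) := by abel
  rw [e, norm_sub_sq_real (q x)]
  linarith

/-- The quadratic gap in the inequality `u x ≤ supConv u y + ‖x - y‖²/2`. -/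
theorem add_sq_le (h : IsEnvelope u q) (hy : y ∈ supDom u) (x : Euc d) :
    u x + ‖y - (x - q x)‖ ^ 2 / 2 ≤ supConv u y + ‖x - y‖ ^ 2 / 2 :=
  h.add_sq_le_of_forall_le (le_supConv_add hy) x

end IsEnvelope

end SupConv

/-! ### Moments -/

namespace IsP2

variable {d : ℕ} {μ : Measure (Euc d)}

theorem integrable_norm_sq (hμ : IsP2 μ) : Integrable (fun x => ‖x‖ ^ 2) μ := by
  refine ⟨by fun_prop, ?_⟩
  rw [HasFiniteIntegral]
  refine lt_of_le_of_lt (le_of_eq ?_) hμ.2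
  congr 1 with x
  rw [enorm_pow, enorm_norm]

theorem integrable_norm (hμ : IsP2 μ) : Integrable (fun x => ‖x‖) μ := by
  have := hμ.1
  refine ((integrable_const (1 : ℝ)).add hμ.integrable_norm_sq).mono' (by fun_prop)
    (Eventually.of_forall fun x => ?_)
  rw [norm_norm, Pi.add_apply]
  nlinarith [sq_nonneg (‖x‖ - 1)]

theorem integrable_of_abs_le (hμ : IsP2 μ) {g : Euc d → ℝ} (hg : AEStronglyMeasurable g μ)
    {a b c : ℝ} (h : ∀ x, |g x| ≤ a + b * ‖x‖ + c * ‖x‖ ^ 2) : Integrable g μ := by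
  have := hμ.1
  exact (((integrable_const a).add (hμ.integrable_norm.const_mul b)).add
    (hμ.integrable_norm_sq.const_mul c)).mono' hg (Eventually.of_forall fun x => h x)

theorem integrable_of_isEnvelope (hμ : IsP2 μ) {u : Euc d → ℝ} {q : Euc d → Euc d}
    (h : IsEnvelope u q) : Integrable u μ := by
  refine hμ.integrable_of_abs_le h.continuous.aestronglyMeasurable (a := |u 0|) (b := ‖q 0‖)
    (c := 1) fun x => ?_
  rw [one_mul]
  exact h.abs_le x

theorem integrable_of_lipschitzWith (hμ : IsP2 μ) {φ : Euc d → ℝ} {L : NNReal}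
    (h : LipschitzWith L φ) : Integrable φ μ := by
  refine hμ.integrable_of_abs_le h.continuous.aestronglyMeasurable (a := |φ 0|) (b := L)
    (c := 0) fun x => ?_
  have h1 := h.dist_le_mul x 0
  rw [Real.dist_eq, dist_zero_right] at h1
  have h2 := abs_sub_abs_le_abs_sub (φ x) (φ 0)
  linarith

end IsP2

/-! ### The dual problem -/

/-- The pairs `(v, F)` competing in the dual problem, with `F` convex on a set of full measure. -/
structure IsDualPair {d : ℕ} (μ ν : Measure (Euc d)) (v F : Euc d → ℝ) (D : Set (Euc d)) :
    Prop where
  convexOn : ConvexOn ℝ D F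
  ae_mem : ∀ᵐ y ∂ν, y ∈ D
  integrable_left : Integrable v μ
  integrable_right : Integrable F ν
  le : ∀ x, ∀ y ∈ D, v x ≤ F y + ‖x - y‖ ^ 2 / 2

section Dual

variable {d : ℕ} {μ ν : Measure (Euc d)} {u v F : Euc d → ℝ} {q : Euc d → Euc d} {D : Set (Euc d)}

/-- The left member of a dual pair can be replaced by a Moreau envelope vanishing at `0`. -/
theorem IsDualPair.exists_isEnvelope (hμ : IsP2 μ) (hν : IsP2 ν) (h : IsDualPair μ ν v F D) :
    ∃ u q F', IsEnvelope u q ∧ u 0 = 0 ∧ IsDualPair μ ν u F' D ∧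
      ∫ x, v x ∂μ - ∫ y, F y ∂ν ≤ ∫ x, u x ∂μ - ∫ y, F' y ∂ν := by
  have := hμ.1
  have := hν.1
  have hD : D.Nonempty := h.ae_mem.exists
  obtain ⟨u, q, hu, hvu, huF⟩ := exists_isEnvelope_between hD h.convexOn h.le
  have hui := hμ.integrable_of_isEnvelope hu
  refine ⟨fun x => u x + -u 0, q, fun y => F y + -u 0, hu.add_const _, by simp,
    ⟨h.convexOn.add (convexOn_const _ h.convexOn.1), h.ae_mem, hui.add (integrable_const _),
      h.integrable_right.add (integrable_const _), fun x y hy => by linarith [huF x y hy]⟩, ?_⟩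
  rw [integral_add hui (integrable_const _), integral_add h.integrable_right (integrable_const _)]
  simp only [integral_const, probReal_univ, one_smul]
  linarith [integral_mono h.integrable_left hui hvu]

/-- Coercivity in q 0: the affine minorant of F attached to the point 0 has constant term ‖q 0‖²/2,
whereas u exceeds its tangent at 0 by at most ‖x‖²/2. Hence the value is bounded above and tends to
-∞ as ‖q 0‖ → ∞. -/
theorem IsDualPair.value_le (hμ : IsP2 μ) (hν : IsP2 ν) (h : IsDualPair μ ν u F D)
    (hu : IsEnvelope u q) (h0 : u 0 = 0) :
    ∫ x, u x ∂μ - ∫ y, F y ∂ν ≤ (∫ x, ‖x‖ ^ 2 ∂μ) / 2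
      + ‖q 0‖ * (∫ x, ‖x‖ ∂μ + ∫ y, ‖y‖ ∂ν) - ‖q 0‖ ^ 2 / 2 := by
  have := hμ.1
  have := hν.1
  have h1 : ∫ x, u x ∂μ ≤ ∫ x, (‖q 0‖ * ‖x‖ + ‖x‖ ^ 2 / 2) ∂μ := by
    refine integral_mono h.integrable_left
      ((hμ.integrable_norm.const_mul _).add (hμ.integrable_norm_sq.div_const 2)) fun x => ?_
    have := hu.upper 0 x
    rw [sub_zero, h0] at this
    linarith [real_inner_le_norm (q 0) x]
  have h2 : ∫ y, (-‖q 0‖ * ‖y‖ + ‖q 0‖ ^ 2 / 2) ∂ν ≤ ∫ y, F y ∂ν := by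
    refine integral_mono_ae ((hν.integrable_norm.const_mul _).add (integrable_const _))
      h.integrable_right ?_
    filter_upwards [h.ae_mem] with y hy
    have := hu.affine_le_of_forall_le (fun x => h.le x y hy) 0
    rw [h0, zero_sub, sub_neg_eq_add, inner_add_right, real_inner_self_eq_norm_sq] at this
    have h3 := (abs_le.1 (abs_real_inner_le_norm (q 0) y)).1
    linarith
  rw [integral_add (hμ.integrable_norm.const_mul _) (hμ.integrable_norm_sq.div_const 2),
    integral_const_mul, integral_div] at h1
  rw [integral_add (hν.integrable_norm.const_mul _) (integrable_const _),
    integral_const_mul] at h2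
  simp only [integral_const, probReal_univ, one_smul] at h2
  linarith

/-- Envelopes vanishing at `0` with bounded gradient at `0` form a sequentially compact set. -/
theorem exists_subseq_tendsto_isEnvelope {U : ℕ → Euc d → ℝ} {Q : ℕ → Euc d → Euc d} {K : ℝ}
    (hU : ∀ n, IsEnvelope (U n) (Q n)) (h0 : ∀ n, U n 0 = 0) (hK : ∀ n, ‖Q n 0‖ ≤ K) :
    ∃ σ : ℕ → ℕ, StrictMono σ ∧ ∃ u q, IsEnvelope u q ∧
      ∀ x, Tendsto (fun n => U (σ n) x) atTop (𝓝 (u x)) := by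
  set z := TopologicalSpace.denseSeq (Euc d)
  have hz := TopologicalSpace.denseRange_denseSeq (Euc d)
  -- Tychonoff's theorem on a dense sequence replaces a diagonal extraction; the local
  -- equi-Lipschitz bound then gives convergence at every point.
  have hcomp : IsCompact (Set.univ.pi fun k : ℕ =>
      Set.Icc (-(K * ‖z k‖ + ‖z k‖ ^ 2)) (K * ‖z k‖ + ‖z k‖ ^ 2)) :=
    isCompact_univ_pi fun k => isCompact_Icc
  obtain ⟨w, -, σ, hσ, hw⟩ := hcomp.tendsto_subseq (x := fun n k => U n (z k)) (by
    intro n k _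
    have h1 := (hU n).abs_le (z k)
    rw [h0, abs_zero, zero_add] at h1
    have h2 := mul_le_mul_of_nonneg_right (hK n) (norm_nonneg (z k))
    exact abs_le.1 (by linarith))
  rw [tendsto_pi_nhds] at hw
  have hcau : ∀ x, CauchySeq fun n => U (σ n) x := by
    intro x
    rw [Metric.cauchySeq_iff']
    intro ε hε
    have hKn : 0 ≤ K := (norm_nonneg _).trans (hK 0)
    set C := K + 2 * ‖x‖ + 1
    have hC : 0 < C := by positivity
    have hδ : 0 < min 1 (ε / (4 * C)) := by positivity
    obtain ⟨k, hk⟩ := hz.exists_dist_lt x hδ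
    rw [dist_eq_norm, lt_min_iff, lt_div_iff₀ (by positivity)] at hk
    have hxk : ∀ n, |U n x - U n (z k)| < ε / 4 := by
      intro n
      refine ((hU n).abs_sub_le x (z k)).trans_lt ?_
      have h1 : ‖z k‖ ≤ ‖x‖ + 1 := by
        have := norm_le_norm_add_norm_sub x (z k)
        linarith [hk.1]
      have h2 : ‖Q n 0‖ + ‖x‖ + ‖z k‖ ≤ C := by linarith [hK n]
      have := mul_le_mul_of_nonneg_right h2 (norm_nonneg (x - z k))
      linarith [hk.2]
    obtain ⟨N, hN⟩ := Metric.cauchySeq_iff'.1 (hw k).cauchySeq (ε / 4) (by positivity)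
    refine ⟨N, fun n hn => ?_⟩
    have h1 := hN n hn
    simp only [Function.comp_apply, Real.dist_eq] at h1 ⊢
    have h2 := abs_lt.1 h1
    have h3 := abs_lt.1 (hxk (σ n))
    have h4 := abs_lt.1 (hxk (σ N))
    rw [abs_lt]
    constructor <;> linarith [h2.1, h2.2, h3.1, h3.2, h4.1, h4.2]
  choose u hu using fun x => cauchySeq_tendsto_of_complete (hcau x)
  have h1 : ConvexOn ℝ Set.univ u := by
    refine ⟨convex_univ, fun a _ b _ s t hs ht hst => ?_⟩
    refine le_of_tendsto_of_tendsto' (hu _) (((hu a).const_smul s).add ((hu b).const_smul t))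
      fun n => (hU (σ n)).convexOn.2 (Set.mem_univ a) (Set.mem_univ b) hs ht hst
  have h2 : ConvexOn ℝ Set.univ fun x => ‖x‖ ^ 2 / 2 - u x := by
    refine ⟨convex_univ, fun a _ b _ s t hs ht hst => ?_⟩
    refine le_of_tendsto_of_tendsto' (tendsto_const_nhds.sub (hu _))
      (((tendsto_const_nhds.sub (hu a)).const_smul s).add
        ((tendsto_const_nhds.sub (hu b)).const_smul t))
      fun n => (hU (σ n)).compl_convexOn.2 (Set.mem_univ a) (Set.mem_univ b) hs ht hst
  obtain ⟨q, hq⟩ := _root_.exists_isEnvelope h1 h2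
  exact ⟨σ, hσ, u, q, hq, hu⟩

/-- Upper semicontinuity of the dual functional along maximizing sequences of envelopes. -/
theorem integrable_supConv_of_tendsto (hμ : IsP2 μ) (hν : IsP2 ν) {U G : ℕ → Euc d → ℝ}
    {Q : ℕ → Euc d → Euc d} {E : ℕ → Set (Euc d)} {K V : ℝ}
    (hU : ∀ n, IsEnvelope (U n) (Q n)) (h0 : ∀ n, U n 0 = 0) (hK : ∀ n, ‖Q n 0‖ ≤ K)
    (hp : ∀ n, IsDualPair μ ν (U n) (G n) (E n))
    (hV : Tendsto (fun n => ∫ x, U n x ∂μ - ∫ y, G n y ∂ν) atTop (𝓝 V))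
    (hlim : ∀ x, Tendsto (fun n => U n x) atTop (𝓝 (u x))) :
    (∀ᵐ y ∂ν, y ∈ supDom u) ∧ Integrable (supConv u) ν ∧
      V ≤ ∫ x, u x ∂μ - ∫ y, supConv u y ∂ν := by
  have := hμ.1
  have := hν.1
  have hintU : Tendsto (fun n => ∫ x, U n x ∂μ) atTop (𝓝 (∫ x, u x ∂μ)) := by
    refine tendsto_integral_of_dominated_convergence (fun x => K * ‖x‖ + ‖x‖ ^ 2)
      (fun n => (hU n).continuous.aestronglyMeasurable)
      ((hμ.integrable_norm.const_mul K).add hμ.integrable_norm_sq) (fun n => ?_)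
      (Eventually.of_forall hlim)
    refine Eventually.of_forall fun x => ?_
    have h1 := (hU n).abs_le x
    rw [h0, abs_zero, zero_add] at h1
    have h2 := mul_le_mul_of_nonneg_right (hK n) (norm_nonneg x)
    rw [Real.norm_eq_abs]
    linarith
  set M := ∫ y, ‖y‖ ∂ν
  have hintG : Tendsto (fun n => ∫ y, (G n y + K * ‖y‖) ∂ν) atTop
      (𝓝 (∫ x, u x ∂μ - V + K * M)) := by
    have := (hintU.sub hV).add_const (K * M)
    refine this.congr fun n => ?_
    rw [integral_add (hp n).integrable_right (hν.integrable_norm.const_mul K), integral_const_mul]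
    ring
  -- Taking x = y in the constraint, G n y ≥ U n y ≥ ⟨Q n 0, y⟩; the shift by K * ‖y‖ makes Fatou's
  -- lemma applicable.
  have hGnn : ∀ n, ∀ᵐ y ∂ν, 0 ≤ G n y + K * ‖y‖ := by
    intro n
    filter_upwards [(hp n).ae_mem] with y hy
    have h1 := (hp n).le y y hy
    have h2 := (hU n).lower 0 y
    rw [h0, sub_zero] at h2
    rw [sub_self, norm_zero] at h1
    have h3 := (abs_le.1 (abs_real_inner_le_norm (Q n 0) y)).1
    have h4 := mul_le_mul_of_nonneg_right (hK n) (norm_nonneg y)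
    linarith
  have hunn : ∀ y, 0 ≤ u y + K * ‖y‖ := by
    intro y
    refine ge_of_tendsto ((hlim y).add_const (K * ‖y‖)) (Eventually.of_forall fun n => ?_)
    have h2 := (hU n).lower 0 y
    rw [h0, sub_zero] at h2
    have h3 := (abs_le.1 (abs_real_inner_le_norm (Q n 0) y)).1
    have h4 := mul_le_mul_of_nonneg_right (hK n) (norm_nonneg y)
    linarith
  set L : Euc d → ℝ≥0∞ := fun y => liminf (fun n => ENNReal.ofReal (G n y + K * ‖y‖)) atTop
  have hmeas : ∀ n, AEMeasurable (fun y => ENNReal.ofReal (G n y + K * ‖y‖)) ν := fun n =>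
    ((hp n).integrable_right.aestronglyMeasurable.aemeasurable.add (by fun_prop)).ennreal_ofReal
  have hfatou : ∫⁻ y, L y ∂ν ≤ ENNReal.ofReal (∫ x, u x ∂μ - V + K * M) := by
    refine (lintegral_liminf_le' hmeas).trans (le_of_eq ?_)
    have : Tendsto (fun n => ∫⁻ y, ENNReal.ofReal (G n y + K * ‖y‖) ∂ν) atTop
        (𝓝 (ENNReal.ofReal (∫ x, u x ∂μ - V + K * M))) := by
      refine (ENNReal.tendsto_ofReal hintG).congr fun n => ?_
      exact ofReal_integral_eq_lintegral_ofReal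
        ((hp n).integrable_right.add (hν.integrable_norm.const_mul K)) (hGnn n)
    exact this.liminf_eq
  have hLm : AEMeasurable L ν := by
    refine ⟨fun y => liminf (fun n => (hmeas n).mk _ y) atTop,
      Measurable.liminf fun n => (hmeas n).measurable_mk, ?_⟩
    filter_upwards [ae_all_iff.2 fun n => (hmeas n).ae_eq_mk] with y hy
    exact congrArg (fun s : ℕ → ℝ≥0∞ => liminf s atTop) (funext hy)
  have hLfin : ∀ᵐ y ∂ν, L y < ∞ :=
    ae_lt_top' hLm (hfatou.trans_lt ENNReal.ofReal_lt_top).ne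
  -- The constraint passes to the limit at each x, so `supConv u` lies below the lower limit of the
  -- G n.
  have hkey : ∀ᵐ y ∂ν, ∀ x, u x - ‖x - y‖ ^ 2 / 2 ≤ (L y).toReal - K * ‖y‖ := by
    filter_upwards [hLfin, ae_all_iff.2 fun n => (hp n).ae_mem] with y hy hmem x
    have h1 : ENNReal.ofReal (u x - ‖x - y‖ ^ 2 / 2 + K * ‖y‖) ≤ L y := by
      have ht : Tendsto (fun n => ENNReal.ofReal (U n x - ‖x - y‖ ^ 2 / 2 + K * ‖y‖)) atTop
          (𝓝 (ENNReal.ofReal (u x - ‖x - y‖ ^ 2 / 2 + K * ‖y‖))) :=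
        ENNReal.tendsto_ofReal (((hlim x).sub_const _).add_const _)
      rw [← ht.liminf_eq]
      refine liminf_le_liminf (Eventually.of_forall fun n => ?_)
      refine ENNReal.ofReal_le_ofReal ?_
      linarith [(hp n).le x y (hmem n)]
    have h2 := (ENNReal.ofReal_le_iff_le_toReal hy.ne).1 h1
    linarith
  have hdom : ∀ᵐ y ∂ν, y ∈ supDom u := hkey.mono fun y hy => mem_supDom_of_forall_le hy
  have hle : ∫⁻ y, ENNReal.ofReal (supConv u y + K * ‖y‖) ∂ν
      ≤ ENNReal.ofReal (∫ x, u x ∂μ - V + K * M) := by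
    refine le_trans (lintegral_mono_ae ?_) hfatou
    filter_upwards [hkey, hLfin] with y hy hL
    rw [ENNReal.ofReal_le_iff_le_toReal hL.ne]
    linarith [supConv_le hy]
  have hnn : ∀ᵐ y ∂ν, 0 ≤ supConv u y + K * ‖y‖ := by
    filter_upwards [hdom] with y hy
    linarith [self_le_supConv hy, hunn y]
  have hsm : AEStronglyMeasurable (fun y => supConv u y + K * ‖y‖) ν :=
    ((measurable_supConv u).add (by fun_prop)).aestronglyMeasurable
  have hint : Integrable (fun y => supConv u y + K * ‖y‖) ν :=
    ⟨hsm, (hasFiniteIntegral_iff_ofReal hnn).2 (hle.trans_lt ENNReal.ofReal_lt_top)⟩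
  have hint' : Integrable (supConv u) ν := by
    refine (hint.sub (hν.integrable_norm.const_mul K)).congr (Eventually.of_forall fun y => ?_)
    simp
  refine ⟨hdom, hint', ?_⟩
  have hpos : 0 ≤ ∫ x, u x ∂μ - V + K * M := by
    refine ge_of_tendsto hintG (Eventually.of_forall fun n => integral_nonneg_of_ae (hGnn n))
  rw [← ofReal_integral_eq_lintegral_ofReal hint hnn, ENNReal.ofReal_le_ofReal_iff hpos,
    integral_add hint' (hν.integrable_norm.const_mul K), integral_const_mul] at hle
  linarith

/-- The dual problem has a solution of the form `(u, supConv u)` with `u` a Moreau envelope. -/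
theorem exists_dual_optimizer (hμ : IsP2 μ) (hν : IsP2 ν) :
    ∃ u q, IsEnvelope u q ∧ (∀ᵐ y ∂ν, y ∈ supDom u) ∧ Integrable (supConv u) ν ∧
      ∀ v F D, IsDualPair μ ν v F D →
        ∫ x, v x ∂μ - ∫ y, F y ∂ν ≤ ∫ x, u x ∂μ - ∫ y, supConv u y ∂ν := by
  have := hμ.1
  have := hν.1
  set S : Set ℝ := {c | ∃ u q F D, IsEnvelope u q ∧ u 0 = 0 ∧ IsDualPair μ ν u F D ∧
    c = ∫ x, u x ∂μ - ∫ y, F y ∂ν}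
  have hS : ∀ v F D, IsDualPair μ ν v F D → ∃ c ∈ S, ∫ x, v x ∂μ - ∫ y, F y ∂ν ≤ c := by
    intro v F D h
    obtain ⟨u, q, F', hu, h0, hp, hle⟩ := h.exists_isEnvelope hμ hν
    exact ⟨_, ⟨u, q, F', D, hu, h0, hp, rfl⟩, hle⟩
  set B := ∫ x, ‖x‖ ^ 2 ∂μ
  set R := ∫ x, ‖x‖ ∂μ + ∫ y, ‖y‖ ∂ν
  have hB : 0 ≤ B := integral_nonneg fun x => sq_nonneg _
  have hR : 0 ≤ R := add_nonneg (integral_nonneg fun x => norm_nonneg _)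
    (integral_nonneg fun x => norm_nonneg _)
  have hbdd : BddAbove S := by
    refine ⟨B / 2 + R ^ 2 / 2, ?_⟩
    rintro c ⟨u, q, F, D, hu, h0, hp, rfl⟩
    have h1 : _ ≤ B / 2 + ‖q 0‖ * R - ‖q 0‖ ^ 2 / 2 := hp.value_le hμ hν hu h0
    nlinarith [sq_nonneg (‖q 0‖ - R)]
  obtain ⟨c, hc, hc0⟩ : ∃ c ∈ S, (0 : ℝ) ≤ c := by
    obtain ⟨c, hc, h⟩ := hS (fun _ => 0) (fun _ => 0) Set.univ
      ⟨convexOn_const _ convex_univ, by simp, integrable_zero _ _ _, integrable_zero _ _ _,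
        fun x y _ => by positivity⟩
    exact ⟨c, hc, by simpa using h⟩
  obtain ⟨C, -, hC, hCS⟩ := exists_seq_tendsto_sSup ⟨c, hc⟩ hbdd
  have hV0 : 0 ≤ sSup S := hc0.trans (le_csSup hbdd hc)
  obtain ⟨N, hN⟩ := eventually_atTop.1 (hC.eventually (lt_mem_nhds (show (-1 : ℝ) < sSup S by
    linarith)))
  choose U Q G E hU hU0 hp hval using fun n => hCS (n + N)
  -- The values exceed -1 from index N on, and for k > 3 + B + 2R the bound B/2 + kR - k²/2 lies
  -- below -1.
  have hK : ∀ n, ‖Q n 0‖ ≤ 1 + B + 2 + 2 * R := by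
    intro n
    have h1 : _ ≤ B / 2 + ‖Q n 0‖ * R - ‖Q n 0‖ ^ 2 / 2 := (hp n).value_le hμ hν (hU n) (hU0 n)
    rw [← hval] at h1
    have h2 := hN (n + N) (by omega)
    by_contra! hlt
    nlinarith [norm_nonneg (Q n 0)]
  obtain ⟨σ, hσ, u, q, hu, hlim⟩ := exists_subseq_tendsto_isEnvelope hU hU0 hK
  have hV : Tendsto (fun n => ∫ x, U (σ n) x ∂μ - ∫ y, G (σ n) y ∂ν) atTop (𝓝 (sSup S)) := by
    simp only [← hval]
    exact (hC.comp (tendsto_add_atTop_nat N)).comp hσ.tendsto_atTop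
  obtain ⟨h1, h2, h3⟩ := integrable_supConv_of_tendsto hμ hν (fun n => hU (σ n))
    (fun n => hU0 (σ n)) (fun n => hK (σ n)) (fun n => hp (σ n)) hV hlim
  refine ⟨u, q, hu, h1, h2, fun v F D h => ?_⟩
  obtain ⟨c, hc, hle⟩ := hS v F D h
  exact (hle.trans (le_csSup hbdd hc)).trans h3

end Dual

/-! ### First-order conditions for the dual optimizer: the backward side -/

theorem le_of_forall_Ioc_le_add_mul {a b c : ℝ} (h : ∀ t ∈ Set.Ioc (0 : ℝ) 1, a ≤ b + t * c) :
    a ≤ b := by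
  have ht : Tendsto (fun t : ℝ => b + t * c) (𝓝[>] 0) (𝓝 b) := by
    have : Continuous fun t : ℝ => b + t * c := by fun_prop
    have h0 := (this.tendsto 0).mono_left (nhdsWithin_le_nhds (s := Set.Ioi 0))
    simpa using h0
  refine ge_of_tendsto ht ?_
  filter_upwards [Ioc_mem_nhdsGT (zero_lt_one' ℝ)] with t ht
  exact h t ht

/-- `u` is a Moreau envelope with gradient `q` and `(u, supConv u)` solves the dual problem. -/
structure IsDualOptimal {d : ℕ} (μ ν : Measure (Euc d)) (u : Euc d → ℝ) (q : Euc d → Euc d) :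
    Prop where
  isEnvelope : IsEnvelope u q
  ae_mem : ∀ᵐ y ∂ν, y ∈ supDom u
  integrable : Integrable (supConv u) ν
  le : ∀ v F D, IsDualPair μ ν v F D →
    ∫ x, v x ∂μ - ∫ y, F y ∂ν ≤ ∫ x, u x ∂μ - ∫ y, supConv u y ∂ν

namespace IsDualOptimal

variable {d : ℕ} {μ ν : Measure (Euc d)} {u : Euc d → ℝ} {q : Euc d → Euc d}

theorem integrable_sq_gradient (hμ : IsP2 μ) (h : IsDualOptimal μ ν u q) :
    Integrable (fun x => ‖q x‖ ^ 2) μ := by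
  refine hμ.integrable_of_abs_le
    ((h.isEnvelope.lipschitzWith.continuous.norm.pow 2).aestronglyMeasurable)
    (a := ‖q 0‖ ^ 2) (b := 2 * ‖q 0‖) (c := 1) fun x => ?_
  rw [abs_of_nonneg (sq_nonneg _)]
  nlinarith [h.isEnvelope.norm_le x, norm_nonneg (q x), norm_nonneg (q 0), norm_nonneg x]

theorem integrable_norm_gradient (hμ : IsP2 μ) (h : IsDualOptimal μ ν u q) :
    Integrable (fun x => ‖q x‖) μ := by
  refine hμ.integrable_of_abs_le
    (h.isEnvelope.lipschitzWith.continuous.norm.aestronglyMeasurable)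
    (a := ‖q 0‖) (b := 1) (c := 0) fun x => ?_
  rw [abs_of_nonneg (norm_nonneg _)]
  linarith [h.isEnvelope.norm_le x]

/-- The competitor F is (1 - t) `supConv u` + tφ. Formally `supConv u` takes the value u x - ‖q
x‖²/2 at x - q x, so u moves at first order by t times the difference between φ and `supConv u` at x
- q x; a correction of order t² makes the pair admissible. -/
theorem backward_variation (hμ : IsP2 μ) (hν : IsP2 ν) (h : IsDualOptimal μ ν u q)
    {φ : Euc d → ℝ} (hφ : ConvexOn ℝ Set.univ φ) {L : NNReal} (hL : LipschitzWith L φ) :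
    ∫ x, φ (x - q x) ∂μ - ∫ x, (u x - ‖q x‖ ^ 2 / 2) ∂μ
      ≤ ∫ y, φ y ∂ν - ∫ y, supConv u y ∂ν := by
  have := hμ.1
  have henv := h.isEnvelope
  have hiu : Integrable u μ := hμ.integrable_of_isEnvelope henv
  have hiq := h.integrable_sq_gradient hμ
  have hiφp : Integrable (fun x => φ (x - q x)) μ :=
    hμ.integrable_of_lipschitzWith (hL.comp henv.lipschitzWith_compl)
  have hif : Integrable (fun x => u x - ‖q x‖ ^ 2 / 2) μ := hiu.sub (hiq.div_const 2)
  have hierr : Integrable (fun x => (L + ‖q x‖) ^ 2 / 2) μ := by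
    have : Integrable (fun x => ((L : ℝ) ^ 2 + 2 * L * ‖q x‖ + ‖q x‖ ^ 2) / 2) μ :=
      (((integrable_const _).add ((h.integrable_norm_gradient hμ).const_mul _)).add
        hiq).div_const 2
    refine this.congr (Eventually.of_forall fun x => ?_)
    simp only
    ring
  have hiφ := hν.integrable_of_lipschitzWith hL
  refine le_of_forall_Ioc_le_add_mul (c := ∫ x, (L + ‖q x‖) ^ 2 / 2 ∂μ) fun t ht => ?_
  have hi₁ : Integrable (fun x => t * (φ (x - q x) - (u x - ‖q x‖ ^ 2 / 2))) μ :=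
    (hiφp.sub hif).const_mul t
  have hi₂ : Integrable (fun x => u x + t * (φ (x - q x) - (u x - ‖q x‖ ^ 2 / 2))) μ :=
    hiu.add hi₁
  have hpair : IsDualPair μ ν
      (fun x => u x + t * (φ (x - q x) - (u x - ‖q x‖ ^ 2 / 2)) - t ^ 2 * ((L + ‖q x‖) ^ 2 / 2))
      (fun y => (1 - t) * supConv u y + t * φ y) (supDom u) := by
    refine ⟨?_, h.ae_mem, ?_, ?_, fun x y hy => ?_⟩
    · have hcv := convexOn_supConv henv.convexOn
      exact (hcv.smul (sub_nonneg.2 ht.2)).add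
        ((hφ.subset (Set.subset_univ _) hcv.1).smul ht.1.le)
    · exact hi₂.sub (hierr.const_mul _)
    · exact (h.integrable.const_mul _).add (hiφ.const_mul _)
    · have hA := henv.add_sq_le hy x
      have hB := hL.dist_le_mul (x - q x) y
      rw [Real.dist_eq, dist_comm, dist_eq_norm] at hB
      have hB' := (abs_le.1 hB).2
      set r := ‖y - (x - q x)‖
      have hC : ‖q x‖ ^ 2 / 2 - ‖q x‖ * r + r ^ 2 / 2 ≤ ‖x - y‖ ^ 2 / 2 := by
        have e : x - y = q x - (y - (x - q x)) := by abel
        rw [e, norm_sub_sq_real (q x)]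
        linarith [real_inner_le_norm (q x) (y - (x - q x))]
      have h1 := mul_le_mul_of_nonneg_left hA (sub_nonneg.2 ht.2)
      have h2 := mul_le_mul_of_nonneg_left hB' ht.1.le
      have h3 := mul_le_mul_of_nonneg_left hC ht.1.le
      -- The gap r²/2 absorbs the linear error t(L + ‖q x‖)r, at the price t²(L + ‖q x‖)²/2
      -- subtracted from v.
      nlinarith [sq_nonneg (r - t * (L + ‖q x‖))]
  have hle := h.le _ _ _ hpair
  rw [integral_sub hi₂ (hierr.const_mul _), integral_add hiu hi₁, integral_const_mul, integral_const_mul,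
    integral_sub hiφp hif, integral_add (h.integrable.const_mul _) (hiφ.const_mul _),
    integral_const_mul, integral_const_mul] at hle
  have ht0 := ht.1
  refine le_of_mul_le_mul_left ?_ ht0
  nlinarith

/-- Convex functions form a cone: the variation for t⁻¹φ, multiplied by t, loses its φ-free terms as
t → 0. -/
theorem integral_comp_compl_le (hμ : IsP2 μ) (hν : IsP2 ν) (h : IsDualOptimal μ ν u q)
    {φ : Euc d → ℝ} (hφ : ConvexOn ℝ Set.univ φ) {L : NNReal} (hL : LipschitzWith L φ) :
    ∫ x, φ (x - q x) ∂μ ≤ ∫ y, φ y ∂ν := by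
  refine le_of_forall_Ioc_le_add_mul
    (c := ∫ x, (u x - ‖q x‖ ^ 2 / 2) ∂μ - ∫ y, supConv u y ∂ν) fun t ht => ?_
  have ht0 : 0 ≤ t⁻¹ := inv_nonneg.2 ht.1.le
  have hL' : LipschitzWith (‖t⁻¹‖₊ * L) fun x => t⁻¹ * φ x :=
    (lipschitzWith_smul t⁻¹).comp hL
  have h1 := h.backward_variation hμ hν (hφ.smul ht0) hL'
  simp only [smul_eq_mul, integral_const_mul] at h1
  have h2 := mul_le_mul_of_nonneg_left h1 ht.1.le
  rw [mul_sub, mul_sub, mul_inv_cancel_left₀ ht.1.ne', mul_inv_cancel_left₀ ht.1.ne'] at h2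
  linarith

/-- The variation with φ = 0. Formally the right side is the integral of `supConv u` against the
image of μ under id - q, so this is the reverse of the convex order inequality. -/
theorem integral_supConv_le (hμ : IsP2 μ) (hν : IsP2 ν) (h : IsDualOptimal μ ν u q) :
    ∫ y, supConv u y ∂ν ≤ ∫ x, (u x - ‖q x‖ ^ 2 / 2) ∂μ := by
  have h1 := h.backward_variation hμ hν (convexOn_const (0 : ℝ) convex_univ)
    (LipschitzWith.const (0 : ℝ))
  simp only [integral_zero, zero_sub] at h1
  linarith

end IsDualOptimal

/-! ### Differentiability of the Legendre transform -/

section Legendre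

variable {d : ℕ} {Φ : Euc d → ℝ} {x y z h : Euc d}

theorem inner_sub_le_toReal_legendre (hz : legendre Φ z ≠ ⊤) (x : Euc d) :
    inner ℝ x z - Φ x ≤ (legendre Φ z).toReal := by
  have h1 := le_iSup (fun x : Euc d => ((inner ℝ x z - Φ x : ℝ) : EReal)) x
  have h2 := EReal.toReal_le_toReal h1 (EReal.coe_ne_bot _) hz
  rwa [EReal.toReal_coe] at h2

theorem toReal_legendre_le {c : ℝ} (h : ∀ x, inner ℝ x z - Φ x ≤ c) :
    (legendre Φ z).toReal ≤ c := by
  have h1 : legendre Φ z ≤ ((c : ℝ) : EReal) := iSup_le fun x => EReal.coe_le_coe_iff.2 (h x)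
  have h2 := EReal.toReal_le_toReal h1 (legendre_ne_bot _ _) (EReal.coe_ne_top _)
  rwa [EReal.toReal_coe] at h2

theorem measurable_extGradient (f : Euc d → EReal) : Measurable (extGradient f) := by
  have : extGradient f = fun y => (InnerProductSpace.toDual ℝ (Euc d)).symm
    (fderiv ℝ (fun z => (f z).toReal) y) := rfl
  rw [this]
  exact (LinearIsometryEquiv.continuous _).measurable.comp (measurable_fderiv ℝ _)

theorem ExtDifferentiableAt.hasGradientAt {f : Euc d → EReal} (hy : ExtDifferentiableAt f y) :
    HasGradientAt (fun z => (f z).toReal) (extGradient f y) y :=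
  hy.2.hasGradientAt

theorem ExtDifferentiableAt.ne_top {f : Euc d → EReal} (hy : ExtDifferentiableAt f y) :
    f y ≠ ⊤ := hy.1.self_of_nhds.1

/-- The Fenchel gap at `(x, y)` controls the component of `x - a` along `h`, up to the remainder
of `Φ*` at `y`. -/
theorem inner_le_gap_add (hyh : legendre Φ (y + h) ≠ ⊤) (x a : Euc d) :
    inner ℝ (x - a) h ≤ ((legendre Φ y).toReal + Φ x - inner ℝ x y) +
      ((legendre Φ (y + h)).toReal - (legendre Φ y).toReal - inner ℝ a h) := by
  have := inner_sub_le_toReal_legendre hyh x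
  rw [inner_add_right] at this
  rw [inner_sub_left]
  linarith

/-- At a point of differentiability of `Φ*`, a small Fenchel gap forces `x` to be close to the
gradient. -/
theorem ExtDifferentiableAt.exists_norm_sub_mul_le (hy : ExtDifferentiableAt (legendre Φ) y)
    {ε : ℝ} (hε : 0 < ε) : ∃ s > 0, ∀ x, ‖x - extGradient (legendre Φ) y‖ * s ≤
      ((legendre Φ y).toReal + Φ x - inner ℝ x y) + ε * s := by
  have h1 := (hasGradientAt_iff_isLittleO.1 hy.hasGradientAt).bound hε
  obtain ⟨δ, hδ, hball⟩ := Metric.eventually_nhds_iff_ball.1 (h1.and hy.1)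
  refine ⟨δ / 2, by positivity, fun x => ?_⟩
  set a := extGradient (legendre Φ) y
  have hgap : 0 ≤ (legendre Φ y).toReal + Φ x - inner ℝ x y := by
    linarith [inner_sub_le_toReal_legendre hy.ne_top x]
  rcases eq_or_ne x a with rfl | hne
  · rw [sub_self, norm_zero, zero_mul]
    positivity
  have hr : 0 < ‖x - a‖ := norm_pos_iff.2 (sub_ne_zero.2 hne)
  -- A step of fixed length δ/2 towards x makes the left side of `inner_le_gap_add` equal to ‖x - a‖
  -- * (δ/2).
  set h := (δ / 2 / ‖x - a‖) • (x - a)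
  have hh : ‖h‖ = δ / 2 := by
    rw [norm_smul, Real.norm_of_nonneg (by positivity), div_mul_cancel₀ _ hr.ne']
  obtain ⟨h2, h3, -⟩ := hball (y + h) (by
    rw [Metric.mem_ball, dist_eq_norm, add_sub_cancel_left, hh]; linarith)
  rw [add_sub_cancel_left, hh, Real.norm_eq_abs] at h2
  have h4 := inner_le_gap_add h3 x a
  have h5 : inner ℝ (x - a) h = ‖x - a‖ * (δ / 2) := by
    rw [real_inner_smul_right, real_inner_self_eq_norm_sq]
    field_simp
  rw [h5] at h4
  linarith [(abs_le.1 h2).2]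

/-- Equality in the Fenchel inequality at the gradient of `Φ*`. -/
theorem ExtDifferentiableAt.toReal_legendre_eq (hΦ : Continuous Φ)
    (hy : ExtDifferentiableAt (legendre Φ) y) :
    (legendre Φ y).toReal =
      inner ℝ (extGradient (legendre Φ) y) y - Φ (extGradient (legendre Φ) y) := by
  set a := extGradient (legendre Φ) y
  refine le_antisymm ?_ (inner_sub_le_toReal_legendre hy.ne_top a)
  by_contra! hlt
  set gap : Euc d → ℝ := fun x => (legendre Φ y).toReal + Φ x - inner ℝ x y
  have hcont : Continuous gap := by fun_prop
  have hga : 0 < gap a := by simp only [gap]; linarith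
  obtain ⟨ε, hε, hball⟩ := Metric.eventually_nhds_iff_ball.1
    (hcont.continuousAt.eventually (lt_mem_nhds (half_lt_self hga)))
  obtain ⟨s, hs, hle⟩ := hy.exists_norm_sub_mul_le (half_pos hε)
  -- The Fenchel gap has infimum 0, and points of small gap lie close to a; continuity then
  -- contradicts gap a > 0.
  have hex : ∃ x, gap x < min (gap a / 2) (ε / 2 * s) := by
    by_contra! hall
    have : (legendre Φ y).toReal ≤ (legendre Φ y).toReal - min (gap a / 2) (ε / 2 * s) :=
      toReal_legendre_le fun x => by
        have := hall x
        simp only [gap] at this ⊢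
        linarith
    have : 0 < min (gap a / 2) (ε / 2 * s) := by positivity
    linarith
  obtain ⟨x, hx⟩ := hex
  have h1 := hle x
  have hx2 : gap x < ε / 2 * s := hx.trans_le (min_le_right _ _)
  have h2 : ‖x - a‖ * s < ε * s := by
    change _ ≤ gap x + _ at h1
    linarith
  have h3 := hball x (by rw [Metric.mem_ball, dist_eq_norm]; exact lt_of_mul_lt_mul_right h2 hs.le)
  linarith [hx.trans_le (min_le_left _ _)]

/-- A maximizer has zero Fenchel gap, hence distance at most ε from the gradient for every ε > 0. -/
theorem ExtDifferentiableAt.eq_extGradient (hy : ExtDifferentiableAt (legendre Φ) y)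
    (hx : ∀ w, inner ℝ w y - Φ w ≤ inner ℝ x y - Φ x) : extGradient (legendre Φ) y = x := by
  have hgap := toReal_legendre_le hx
  have : ‖x - extGradient (legendre Φ) y‖ ≤ 0 := by
    refine le_of_forall_pos_le_add fun ε hε => ?_
    obtain ⟨s, hs, hle⟩ := hy.exists_norm_sub_mul_le hε
    refine le_of_mul_le_mul_right ?_ hs
    linarith [hle x]
  exact (sub_eq_zero.1 (norm_le_zero_iff.1 this)).symm

end Legendre

/-- For absolutely continuous `ν` carried by the domain of `Φ*`, the transform `Φ*` is
differentiable `ν`-almost everywhere. -/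
theorem ae_extDifferentiableAt {d : ℕ} {ν : Measure (Euc d)} (hν : ν ≪ volume) {u : Euc d → ℝ}
    (hu : ConvexOn ℝ Set.univ u) (hmem : ∀ᵐ y ∂ν, y ∈ supDom u) :
    ∀ᵐ y ∂ν, ExtDifferentiableAt (legendre fun x => ‖x‖ ^ 2 / 2 - u x) y := by
  set G : Euc d → ℝ := fun z => (legendre (fun x => ‖x‖ ^ 2 / 2 - u x) z).toReal
  have hcv := convexOn_supConv hu
  have hG : ConvexOn ℝ (supDom u) G := by
    have hsq : ConvexOn ℝ Set.univ fun x : Euc d => ‖x‖ ^ 2 :=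
      (convexOn_norm convex_univ).pow (fun x _ => norm_nonneg x) 2
    have := hcv.add ((hsq.subset (Set.subset_univ _) hcv.1).smul (show (0 : ℝ) ≤ 1 / 2 by norm_num))
    refine this.congr fun y _ => ?_
    simp only [Pi.add_apply, supConv, smul_eq_mul, G]
    ring
  -- Convex functions are locally Lipschitz in the interior of their domain, where Rademacher's
  -- theorem applies locally.
  have hnull : volume {y | y ∈ interior (supDom u) ∧ ¬ DifferentiableAt ℝ G y} = 0 := by
    refine measure_null_of_locally_null _ fun y hy => ?_
    obtain ⟨K, t, ht, hL⟩ := hG.locallyLipschitzOn_interior hy.1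
    rw [isOpen_interior.nhdsWithin_eq hy.1] at ht
    refine ⟨{y | y ∈ interior t ∧ ¬ DifferentiableAt ℝ G y}, ?_, ?_⟩
    · filter_upwards [mem_nhdsWithin_of_mem_nhds (interior_mem_nhds.2 ht), self_mem_nhdsWithin]
        with z hz hz' using ⟨hz, hz'.2⟩
    · have := hL.ae_differentiableWithinAt_of_mem (μ := volume)
      rw [ae_iff] at this
      refine measure_mono_null (fun z hz => ?_) this
      rw [Set.mem_ofPred_eq, Classical.not_imp]
      exact ⟨interior_subset hz.1, fun hd => hz.2 (hd.differentiableAt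
        (mem_interior_iff_mem_nhds.1 hz.1))⟩
  have hfr : ∀ᵐ y ∂ν, y ∉ frontier (supDom u) :=
    hν.ae_le (measure_eq_zero_iff_ae_notMem.1 (hcv.1.addHaar_frontier volume))
  have hdiff : ∀ᵐ y ∂ν, ¬ (y ∈ interior (supDom u) ∧ ¬ DifferentiableAt ℝ G y) :=
    hν.ae_le (measure_eq_zero_iff_ae_notMem.1 hnull)
  filter_upwards [hmem, hfr, hdiff] with y h1 h2 h3
  have hint : y ∈ interior (supDom u) := by
    by_contra h
    exact h2 ⟨subset_closure h1, h⟩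
  refine ⟨?_, by_contra fun h => h3 ⟨hint, h⟩⟩
  filter_upwards [mem_interior_iff_mem_nhds.1 hint] with z hz using ⟨hz, legendre_ne_bot _ _⟩

/-! ### First-order conditions for the dual optimizer: the forward side -/

section Forward

variable {d : ℕ} {μ ν : Measure (Euc d)} {u : Euc d → ℝ} {q : Euc d → Euc d}

theorem gap_eq (u : Euc d → ℝ) (x y : Euc d) :
    (legendre (fun x => ‖x‖ ^ 2 / 2 - u x) y).toReal + (‖x‖ ^ 2 / 2 - u x) - inner ℝ x y
      = supConv u y + ‖x - y‖ ^ 2 / 2 - u x := by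
  rw [supConv, norm_sub_sq_real]
  ring

theorem supConv_eq_of_extDifferentiableAt (hu : Continuous u) {y : Euc d}
    (hy : ExtDifferentiableAt (legendre fun x => ‖x‖ ^ 2 / 2 - u x) y) :
    u (extGradient (legendre fun x => ‖x‖ ^ 2 / 2 - u x) y) = supConv u y +
      ‖extGradient (legendre fun x => ‖x‖ ^ 2 / 2 - u x) y - y‖ ^ 2 / 2 := by
  have h1 := hy.toReal_legendre_eq (by fun_prop)
  have h2 := gap_eq u (extGradient (legendre fun x => ‖x‖ ^ 2 / 2 - u x) y) y
  linarith

/-- The upper half of an envelope theorem at y. Moving x away from a gains at most order t‖x - a‖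
and loses (1 - t) times the Fenchel gap; by `exists_norm_sub_mul_le` the loss covers the gain up to
tε. -/
theorem forward_variation_le (hu : Continuous u) {y : Euc d}
    (hy : ExtDifferentiableAt (legendre fun x => ‖x‖ ^ 2 / 2 - u x) y) {ψ : Euc d → ℝ}
    {L : NNReal} (hL : LipschitzWith L ψ) {ε : ℝ} (hε : 0 < ε) :
    ∃ t₀ > 0, ∀ t, 0 < t → t ≤ t₀ → ∀ x, (1 - t) * u x + t * ψ x - ‖x - y‖ ^ 2 / 2 ≤
      supConv u y + t * (ψ (extGradient (legendre fun x => ‖x‖ ^ 2 / 2 - u x) y)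
        - u (extGradient (legendre fun x => ‖x‖ ^ 2 / 2 - u x) y) + ε) := by
  have hua := supConv_eq_of_extDifferentiableAt hu hy
  set a := extGradient (legendre fun x => ‖x‖ ^ 2 / 2 - u x) y
  set C : ℝ := L + ‖a - y‖
  have hC : 0 ≤ C := by positivity
  obtain ⟨s, hs, hle⟩ := hy.exists_norm_sub_mul_le (ε := ε / (C + 1)) (by positivity)
  -- The condition t ≤ s/(C + s) says exactly tC ≤ (1 - t)s.
  refine ⟨s / (C + s), by positivity, fun t ht htle x => ?_⟩
  rw [le_div_iff₀ (by positivity)] at htle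
  have h1 := hle x
  rw [gap_eq] at h1
  have hg : 0 ≤ supConv u y + ‖x - y‖ ^ 2 / 2 - u x := by
    linarith [le_supConv_add (u := u) hy.ne_top x]
  set g := supConv u y + ‖x - y‖ ^ 2 / 2 - u x with hgdef
  set r := ‖x - a‖
  have hψ : ψ x ≤ ψ a + L * r := by
    have := hL.dist_le_mul x a
    rw [Real.dist_eq, dist_eq_norm] at this
    linarith [(abs_le.1 this).2]
  have hq : ‖a - y‖ ^ 2 / 2 - ‖a - y‖ * r ≤ ‖x - y‖ ^ 2 / 2 := by
    have e : x - y = (a - y) + (x - a) := by abel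
    rw [e, norm_add_sq_real]
    have := (abs_le.1 (abs_real_inner_le_norm (a - y) (x - a))).1
    nlinarith [sq_nonneg ‖x - a‖]
  have hCr : t * (C * r) ≤ (1 - t) * g + t * ε := by
    have h2 : C * (ε / (C + 1)) ≤ ε := by
      rw [mul_div_assoc', div_le_iff₀ (by positivity)]
      nlinarith
    have h3 := mul_le_mul_of_nonneg_left h1 (mul_nonneg ht.le hC)
    have h4 := mul_le_mul_of_nonneg_left h2 (mul_nonneg ht.le hs.le)
    have h5 := mul_le_mul_of_nonneg_right htle hg
    refine le_of_mul_le_mul_right ?_ hs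
    nlinarith
  have h6 := mul_le_mul_of_nonneg_left hψ ht.le
  have h7 := mul_le_mul_of_nonneg_left hq ht.le
  have h8 : u x = supConv u y + ‖x - y‖ ^ 2 / 2 - g := by linarith
  rw [h8, hua]
  have h9 : t * (C * r) = t * (L * r) + t * (‖a - y‖ * r) := by simp only [C]; ring
  nlinarith

/-- Competitors are (1 - t)u + tψ with their supremal convolutions. The difference quotients of the
latter converge ν-a.e. to ψ - u at the gradient of Φ*, which is the first-order condition once the
limit is taken under the integral. -/
theorem IsDualOptimal.forward_variation (hμ : IsP2 μ) (hν : IsP2 ν) (hac : ν ≪ volume)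
    (h : IsDualOptimal μ ν u q) {ψ : Euc d → ℝ} (hψ : ConvexOn ℝ Set.univ ψ) {L : NNReal}
    (hL : LipschitzWith L ψ) :
    Integrable (fun y => ψ (extGradient (legendre fun x => ‖x‖ ^ 2 / 2 - u x) y)
        - u (extGradient (legendre fun x => ‖x‖ ^ 2 / 2 - u x) y)) ν ∧
      ∫ x, (ψ x - u x) ∂μ ≤ ∫ y, (ψ (extGradient (legendre fun x => ‖x‖ ^ 2 / 2 - u x) y)
        - u (extGradient (legendre fun x => ‖x‖ ^ 2 / 2 - u x) y)) ∂ν := by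
  have := hν.1
  have henv := h.isEnvelope
  have hcont := henv.continuous
  have hdiff := ae_extDifferentiableAt hac henv.convexOn h.ae_mem
  have hgm := measurable_extGradient (legendre fun x => ‖x‖ ^ 2 / 2 - u x)
  set X := extGradient (legendre fun x => ‖x‖ ^ 2 / 2 - u x)
  have hiu := hμ.integrable_of_isEnvelope henv
  have hiuν := hν.integrable_of_isEnvelope henv
  have hiψ := hμ.integrable_of_lipschitzWith hL
  have hiψν := hν.integrable_of_lipschitzWith hL
  -- For L-Lipschitz ψ, sup_x (ψ x - ‖x - y‖²/2) ≤ ψ y + L²/2, so H is an integrable majorant of all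
  -- the difference quotients.
  set H : Euc d → ℝ := fun y => ψ y + (L : ℝ) ^ 2 / 2 - supConv u y
  have hiH : Integrable H ν := (hiψν.add (integrable_const _)).sub h.integrable
  set t : ℕ → ℝ := fun n => 1 / ((n : ℝ) + 1)
  have ht0 : ∀ n, 0 < t n := fun n => Nat.one_div_pos_of_nat
  have ht1 : ∀ n, t n ≤ 1 := fun n => by
    simp only [t]
    rw [div_le_one (by positivity)]
    linarith [Nat.cast_nonneg (α := ℝ) n]
  have htlim : Tendsto t atTop (𝓝 0) := tendsto_one_div_add_atTop_nhds_zero_nat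
  set v : ℕ → Euc d → ℝ := fun n x => (1 - t n) * u x + t n * ψ x
  have hv : ∀ n, ConvexOn ℝ Set.univ (v n) := fun n =>
    (henv.convexOn.smul (sub_nonneg.2 (ht1 n))).add (hψ.smul (ht0 n).le)
  have hvle : ∀ n, ∀ y ∈ supDom u, ∀ x,
      v n x - ‖x - y‖ ^ 2 / 2 ≤ supConv u y + t n * H y := by
    intro n y hy x
    have h1 := mul_le_mul_of_nonneg_left (le_supConv hy x) (sub_nonneg.2 (ht1 n))
    have h2 : ψ x - ‖x - y‖ ^ 2 / 2 ≤ ψ y + (L : ℝ) ^ 2 / 2 := by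
      have := hL.dist_le_mul x y
      rw [Real.dist_eq, dist_eq_norm] at this
      nlinarith [(abs_le.1 this).2, sq_nonneg (‖x - y‖ - L)]
    have h3 := mul_le_mul_of_nonneg_left h2 (ht0 n).le
    simp only [v, H]
    linarith
  have hvdom : ∀ n, supDom u ⊆ supDom (v n) := fun n y hy =>
    mem_supDom_of_forall_le (hvle n y hy)
  have hvup : ∀ n, ∀ y ∈ supDom u, supConv (v n) y ≤ supConv u y + t n * H y := fun n y hy =>
    supConv_le (hvle n y hy)
  have hiv : ∀ n, Integrable (supConv (v n)) ν := by
    intro n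
    have hlow : Integrable (v n) ν := (hiuν.const_mul _).add (hiψν.const_mul _)
    refine integrable_of_le_of_le (measurable_supConv _).aestronglyMeasurable
      (g₁ := v n) (g₂ := fun y => supConv u y + t n * H y) ?_ ?_ hlow
      (h.integrable.add (hiH.const_mul _))
    · filter_upwards [h.ae_mem] with y hy using self_le_supConv (hvdom n hy)
    · filter_upwards [h.ae_mem] with y hy using hvup n y hy
  -- Subtracting from the majorant gives nonnegative functions, so Fatou's lemma needs no integrable
  -- lower bound on the quotients and gives the integrability of the limit as well.
  set k : ℕ → Euc d → ℝ := fun n y => H y - (supConv (v n) y - supConv u y) / t n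
  have hid : ∀ n, Integrable (fun y => (supConv (v n) y - supConv u y) / t n) ν := fun n =>
    ((hiv n).sub h.integrable).div_const _
  have hik : ∀ n, Integrable (k n) ν := fun n => hiH.sub (hid n)
  have hknn : ∀ n, ∀ᵐ y ∂ν, 0 ≤ k n y := by
    intro n
    filter_upwards [h.ae_mem] with y hy
    simp only [k, sub_nonneg]
    rw [div_le_iff₀ (ht0 n)]
    linarith [hvup n y hy]
  have hkint : ∀ n, ∫ y, k n y ∂ν ≤ ∫ y, H y ∂ν - ∫ x, (ψ x - u x) ∂μ := by
    intro n
    have hpair : IsDualPair μ ν (v n) (supConv (v n)) (supDom (v n)) :=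
      ⟨convexOn_supConv (hv n), h.ae_mem.mono fun y hy => hvdom n hy,
        (hiu.const_mul _).add (hiψ.const_mul _), hiv n, fun x y hy => le_supConv_add hy x⟩
    have h1 := h.le _ _ _ hpair
    have e1 : ∫ x, v n x ∂μ = (1 - t n) * ∫ x, u x ∂μ + t n * ∫ x, ψ x ∂μ := by
      simp only [v]
      rw [integral_add (hiu.const_mul _) (hiψ.const_mul _), integral_const_mul, integral_const_mul]
    have e2 : ∫ y, k n y ∂ν
        = ∫ y, H y ∂ν - (∫ y, supConv (v n) y ∂ν - ∫ y, supConv u y ∂ν) / t n := by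
      rw [← integral_sub (hiv n) h.integrable, ← integral_div]
      exact integral_sub hiH (hid n)
    rw [e2, integral_sub hiψ hiu]
    have h2 : ∫ x, ψ x ∂μ - ∫ x, u x ∂μ
        ≤ (∫ y, supConv (v n) y ∂ν - ∫ y, supConv u y ∂ν) / t n := by
      rw [le_div_iff₀ (ht0 n)]
      linarith
    linarith
  have hXlow : ∀ n, ∀ y, ExtDifferentiableAt (legendre fun x => ‖x‖ ^ 2 / 2 - u x) y →
      supConv u y + t n * (ψ (X y) - u (X y)) ≤ supConv (v n) y := by
    intro n y hy
    have h1 := le_supConv (hvdom n hy.ne_top) (X y)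
    have h2 : u (X y) = supConv u y + ‖X y - y‖ ^ 2 / 2 :=
      supConv_eq_of_extDifferentiableAt hcont hy
    simp only [v] at h1
    linarith
  have hklim : ∀ᵐ y ∂ν, Tendsto (fun n => k n y) atTop (𝓝 (H y - (ψ (X y) - u (X y)))) := by
    filter_upwards [hdiff] with y hy
    refine tendsto_const_nhds.sub ?_
    rw [tendsto_order]
    constructor
    · intro c hc
      refine Eventually.of_forall fun n => hc.trans_le ?_
      rw [le_div_iff₀ (ht0 n)]
      linarith [hXlow n y hy]
    · intro c hc
      obtain ⟨t₀, ht₀, hle⟩ := forward_variation_le hcont hy hL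
        (ε := (c - (ψ (X y) - u (X y))) / 2) (by linarith)
      filter_upwards [htlim.eventually (gt_mem_nhds ht₀)] with n hn
      have h1 := supConv_le (u := v n) (hle (t n) (ht0 n) hn.le)
      rw [div_lt_iff₀ (ht0 n)]
      have h2 : 0 < t n * ((c - (ψ (X y) - u (X y))) / 2) := mul_pos (ht0 n) (by linarith)
      change _ ≤ supConv u y + t n * (ψ (X y) - u (X y) + (c - (ψ (X y) - u (X y))) / 2) at h1
      linarith
  have hnn : ∀ᵐ y ∂ν, 0 ≤ H y - (ψ (X y) - u (X y)) := by
    filter_upwards [hklim, ae_all_iff.2 hknn] with y h1 h2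
    exact ge_of_tendsto h1 (Eventually.of_forall h2)
  have hfatou : ∫⁻ y, ENNReal.ofReal (H y - (ψ (X y) - u (X y))) ∂ν
      ≤ ENNReal.ofReal (∫ y, H y ∂ν - ∫ x, (ψ x - u x) ∂μ) := by
    calc ∫⁻ y, ENNReal.ofReal (H y - (ψ (X y) - u (X y))) ∂ν
        = ∫⁻ y, liminf (fun n => ENNReal.ofReal (k n y)) atTop ∂ν := by
          refine lintegral_congr_ae ?_
          filter_upwards [hklim] with y hy
          exact (ENNReal.tendsto_ofReal hy).liminf_eq.symm
      _ ≤ liminf (fun n => ∫⁻ y, ENNReal.ofReal (k n y) ∂ν) atTop :=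
          lintegral_liminf_le' fun n => (hik n).aestronglyMeasurable.aemeasurable.ennreal_ofReal
      _ ≤ liminf (fun _ : ℕ => ENNReal.ofReal (∫ y, H y ∂ν - ∫ x, (ψ x - u x) ∂μ)) atTop := by
          refine liminf_le_liminf (Eventually.of_forall fun n => ?_)
          rw [← ofReal_integral_eq_lintegral_ofReal (hik n) (hknn n)]
          exact ENNReal.ofReal_le_ofReal (hkint n)
      _ = _ := liminf_const _
  have hsm : AEStronglyMeasurable (fun y => H y - (ψ (X y) - u (X y))) ν :=
    hiH.aestronglyMeasurable.sub ((hL.continuous.measurable.comp hgm).sub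
      (hcont.measurable.comp hgm)).aestronglyMeasurable
  have hint : Integrable (fun y => H y - (ψ (X y) - u (X y))) ν :=
    ⟨hsm, (hasFiniteIntegral_iff_ofReal hnn).2 (hfatou.trans_lt ENNReal.ofReal_lt_top)⟩
  have hint' : Integrable (fun y => ψ (X y) - u (X y)) ν := by
    refine (hiH.sub hint).congr (Eventually.of_forall fun y => ?_)
    simp
  refine ⟨hint', ?_⟩
  have hpos : 0 ≤ ∫ y, H y ∂ν - ∫ x, (ψ x - u x) ∂μ :=
    (integral_nonneg_of_ae (hknn 0)).trans (hkint 0)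
  rw [← ofReal_integral_eq_lintegral_ofReal hint hnn, ENNReal.ofReal_le_ofReal_iff hpos,
    integral_sub hiH hint'] at hfatou
  linarith

end Forward

/-! ### Convex order -/

section Order

variable {d : ℕ} {η ν : Measure (Euc d)}

theorem MeasureTheory.Integrable.lintegral_ofReal_ne_top {φ : Euc d → ℝ} (h : Integrable φ η) :
    ∫⁻ x, ENNReal.ofReal (φ x) ∂η ≠ ∞ := by
  refine ((lintegral_mono fun x => ?_).trans_lt h.2).ne
  rw [← ofReal_norm]
  exact ENNReal.ofReal_le_ofReal (le_abs_self _)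

theorem extIntegral_eq_integral {φ : Euc d → ℝ} (h : Integrable φ η) :
    extIntegral η φ = ((∫ x, φ x ∂η : ℝ) : EReal) := by
  have hneg : ∫⁻ x, ENNReal.ofReal (-φ x) ∂η ≠ ∞ := h.neg.lintegral_ofReal_ne_top
  rw [extIntegral, integral_eq_lintegral_pos_part_sub_lintegral_neg_part h, EReal.coe_sub,
    EReal.coe_ennreal_toReal h.lintegral_ofReal_ne_top, EReal.coe_ennreal_toReal hneg]

theorem ConvexOrder.integral_le (h : ConvexOrder η ν) {φ : Euc d → ℝ}
    (hφ : ConvexOn ℝ Set.univ φ) (hη : Integrable φ η) (hν : Integrable φ ν) :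
    ∫ x, φ x ∂η ≤ ∫ y, φ y ∂ν := by
  have := h φ hφ (Or.inl hη.lintegral_ofReal_ne_top) (Or.inl hν.lintegral_ofReal_ne_top)
  rwa [extIntegral_eq_integral hη, extIntegral_eq_integral hν, EReal.coe_le_coe_iff] at this

/-- Monotone convergence for functions whose integrals are bounded above. -/
theorem integrable_of_monotone_of_integral_le {f : ℕ → Euc d → ℝ} {g : Euc d → ℝ} {c : ℝ}
    (hf : ∀ n, Integrable (f n) η) (hm : ∀ y, Monotone fun n => f n y)
    (hc : ∀ n, ∫ y, f n y ∂η ≤ c) (hg : AEStronglyMeasurable g η)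
    (hfg : ∀ y b, (∀ n, f n y ≤ b) → f 0 y ≤ g y ∧ g y ≤ b) :
    (∀ᵐ y ∂η, ∃ b, ∀ n, f n y ≤ b) ∧ Integrable g η ∧ ∫ y, g y ∂η ≤ c := by
  set S : Euc d → ℝ≥0∞ := fun y => ⨆ n, ENNReal.ofReal (f n y - f 0 y)
  have hmeas : ∀ n, AEMeasurable (fun y => ENNReal.ofReal (f n y - f 0 y)) η := fun n =>
    ((hf n).sub (hf 0)).aestronglyMeasurable.aemeasurable.ennreal_ofReal
  have hS : ∫⁻ y, S y ∂η ≤ ENNReal.ofReal (c - ∫ y, f 0 y ∂η) := by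
    rw [lintegral_iSup' hmeas (Eventually.of_forall fun y n m hnm =>
      ENNReal.ofReal_le_ofReal (sub_le_sub_right (hm y hnm) _))]
    refine iSup_le fun n => ?_
    have hs : Integrable (fun y => f n y - f 0 y) η := (hf n).sub (hf 0)
    rw [← ofReal_integral_eq_lintegral_ofReal hs
      (Eventually.of_forall fun y => sub_nonneg.2 (hm y n.zero_le)), integral_sub (hf n) (hf 0)]
    exact ENNReal.ofReal_le_ofReal (by linarith [hc n])
  have hfin : ∀ᵐ y ∂η, S y < ∞ :=
    ae_lt_top' (AEMeasurable.iSup hmeas) (hS.trans_lt ENNReal.ofReal_lt_top).ne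
  have hb : ∀ y, S y < ∞ → ∀ n, f n y ≤ f 0 y + (S y).toReal := by
    intro y hy n
    have := (ENNReal.ofReal_le_iff_le_toReal hy.ne).1
      (le_iSup (fun n => ENNReal.ofReal (f n y - f 0 y)) n)
    linarith
  have hnn : ∀ᵐ y ∂η, 0 ≤ g y - f 0 y := by
    filter_upwards [hfin] with y hy
    linarith [(hfg y _ (hb y hy)).1]
  have hle : ∫⁻ y, ENNReal.ofReal (g y - f 0 y) ∂η ≤ ENNReal.ofReal (c - ∫ y, f 0 y ∂η) := by
    refine (lintegral_mono_ae ?_).trans hS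
    filter_upwards [hfin] with y hy
    rw [ENNReal.ofReal_le_iff_le_toReal hy.ne]
    linarith [(hfg y _ (hb y hy)).2]
  have hint : Integrable (fun y => g y - f 0 y) η :=
    ⟨hg.sub (hf 0).aestronglyMeasurable,
      (hasFiniteIntegral_iff_ofReal hnn).2 (hle.trans_lt ENNReal.ofReal_lt_top)⟩
  have hint' : Integrable g η := by
    refine (hint.add (hf 0)).congr (Eventually.of_forall fun y => ?_)
    simp
  refine ⟨hfin.mono fun y hy => ⟨_, hb y hy⟩, hint', ?_⟩
  have hpos : 0 ≤ c - ∫ y, f 0 y ∂η := by linarith [hc 0]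
  rw [← ofReal_integral_eq_lintegral_ofReal hint hnn, ENNReal.ofReal_le_ofReal_iff hpos,
    integral_sub hint' (hf 0)] at hle
  linarith

/-! ### Reduction of the convex order to Lipschitz test functions -/

/-- The maximum of finitely many affine functions. -/
noncomputable def affineMax (l : ℕ → Euc d →L[ℝ] ℝ) (c : ℕ → ℝ) (n : ℕ) : Euc d → ℝ :=
  partialSups (fun k y => l k y + c k) n

section AffineMax

variable (l : ℕ → Euc d →L[ℝ] ℝ) (c : ℕ → ℝ)

theorem affineMax_zero : affineMax l c 0 = fun y => l 0 y + c 0 := partialSups_zero _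

theorem affineMax_succ (n : ℕ) :
    affineMax l c (n + 1) = affineMax l c n ⊔ fun y => l (n + 1) y + c (n + 1) :=
  partialSups_succ _ n

theorem affineMax_monotone (y : Euc d) : Monotone fun n => affineMax l c n y :=
  fun _ _ h => (partialSups fun k y => l k y + c k).monotone h y

theorem le_affineMax (n : ℕ) (y : Euc d) : l n y + c n ≤ affineMax l c n y :=
  le_partialSups (fun k y => l k y + c k) n y

theorem affineMax_le {y : Euc d} {b : ℝ} (n : ℕ) (h : ∀ k, l k y + c k ≤ b) :
    affineMax l c n y ≤ b := by
  induction n with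
  | zero => rw [affineMax_zero]; exact h 0
  | succ n ih => rw [affineMax_succ]; exact sup_le ih (h _)

theorem convexOn_affine (l : Euc d →L[ℝ] ℝ) (c : ℝ) :
    ConvexOn ℝ Set.univ fun y => l y + c :=
  (l.toLinearMap.convexOn convex_univ).add (convexOn_const c convex_univ)

theorem convexOn_affineMax (n : ℕ) : ConvexOn ℝ Set.univ (affineMax l c n) := by
  induction n with
  | zero => rw [affineMax_zero]; exact convexOn_affine _ _
  | succ n ih => rw [affineMax_succ]; exact ih.sup (convexOn_affine _ _)

theorem lipschitzWith_affine (l : Euc d →L[ℝ] ℝ) (c : ℝ) :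
    LipschitzWith ‖l‖₊ fun y => l y + c :=
  LipschitzWith.of_dist_le_mul fun x y => by
    rw [dist_add_right]
    exact l.lipschitz.dist_le_mul x y

theorem exists_lipschitzWith_affineMax (n : ℕ) : ∃ L, LipschitzWith L (affineMax l c n) := by
  induction n with
  | zero => rw [affineMax_zero]; exact ⟨_, lipschitzWith_affine _ _⟩
  | succ n ih =>
    obtain ⟨L, hL⟩ := ih
    rw [affineMax_succ]
    exact ⟨_, hL.max (lipschitzWith_affine _ _)⟩

end AffineMax

/-- If `η` is below `ν` on Lipschitz convex functions, the same holds for countable suprema of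
affine functions dominated by a `ν`-integrable function. -/
theorem integral_le_of_affine_le (hη : IsP2 η) (hν : IsP2 ν)
    (H : ∀ φ : Euc d → ℝ, ConvexOn ℝ Set.univ φ → (∃ L, LipschitzWith L φ) →
      ∫ x, φ x ∂η ≤ ∫ y, φ y ∂ν)
    {l : ℕ → Euc d →L[ℝ] ℝ} {c : ℕ → ℝ} {g F : Euc d → ℝ} (hF : Integrable F ν)
    (hlF : ∀ᵐ y ∂ν, ∀ k, l k y + c k ≤ F y) (hg : AEStronglyMeasurable g η)
    (hlg : ∀ y b, (∀ k, l k y + c k ≤ b) → l 0 y + c 0 ≤ g y ∧ g y ≤ b) :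
    (∀ᵐ y ∂η, ∃ b, ∀ k, l k y + c k ≤ b) ∧ Integrable g η ∧ ∫ y, g y ∂η ≤ ∫ y, F y ∂ν := by
  have hint : ∀ {ρ : Measure (Euc d)}, IsP2 ρ → ∀ n, Integrable (affineMax l c n) ρ := by
    intro ρ hρ n
    obtain ⟨L, hL⟩ := exists_lipschitzWith_affineMax l c n
    exact hρ.integrable_of_lipschitzWith hL
  have hc : ∀ n, ∫ y, affineMax l c n y ∂η ≤ ∫ y, F y ∂ν := by
    intro n
    refine (H _ (convexOn_affineMax l c n) (exists_lipschitzWith_affineMax l c n)).trans ?_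
    refine integral_mono_ae (hint hν n) hF ?_
    filter_upwards [hlF] with y hy using affineMax_le l c n hy
  obtain ⟨h1, h2⟩ := integrable_of_monotone_of_integral_le (hint hη) (affineMax_monotone l c) hc hg
    fun y b hb => by
      rw [affineMax_zero]
      exact hlg y b fun k => (le_affineMax l c k y).trans (hb k)
  refine ⟨h1.mono fun y hy => ?_, h2⟩
  obtain ⟨b, hb⟩ := hy
  exact ⟨b, fun k => (le_affineMax l c k y).trans (hb k)⟩

/-- A real convex function is the supremum of countably many affine functions. Their finite maxima
are convex and Lipschitz, and monotone convergence does the rest. -/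
theorem convexOrder_of_lipschitz (hη : IsP2 η) (hν : IsP2 ν)
    (H : ∀ φ : Euc d → ℝ, ConvexOn ℝ Set.univ φ → (∃ L, LipschitzWith L φ) →
      ∫ x, φ x ∂η ≤ ∫ y, φ y ∂ν) : ConvexOrder η ν := by
  intro φ hφ _ hEν
  have hcont : Continuous φ := hφ.locallyLipschitz.continuous
  by_cases htop : ∫⁻ y, ENNReal.ofReal (φ y) ∂ν = ∞
  · have h2 := hEν.resolve_left (not_not_intro htop)
    rw [extIntegral.eq_1 ν, htop, EReal.coe_ennreal_top, ← EReal.coe_ennreal_toReal h2,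
      EReal.top_sub_coe]
    exact le_top
  obtain ⟨l, c, hle, hsup⟩ := hφ.real_univ_sSup_of_nat_affine_eq hcont.lowerSemicontinuous
  have hle' : ∀ k y, l k y + c k ≤ φ y := fun k y => hle k y
  have hintν : Integrable φ ν := by
    have hmax : Integrable (fun y => max (φ y) 0) ν := by
      refine ⟨(hcont.max continuous_const).aestronglyMeasurable, ?_⟩
      rw [hasFiniteIntegral_iff_ofReal (f := fun y => max (φ y) 0)
        (Eventually.of_forall fun y => le_max_right _ _)]
      refine lt_of_le_of_lt (le_of_eq ?_) (lt_top_iff_ne_top.2 htop)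
      congr 1 with y
      rcases le_total (φ y) 0 with h | h
      · rw [max_eq_right h, ENNReal.ofReal_of_nonpos h, ENNReal.ofReal_zero]
      · rw [max_eq_left h]
    exact integrable_of_le_of_le hcont.aestronglyMeasurable
      (Eventually.of_forall (hle' 0)) (Eventually.of_forall fun y => le_max_left _ _)
      (hν.integrable_of_lipschitzWith (lipschitzWith_affine (l 0) (c 0))) hmax
  obtain ⟨-, hintη, hfin⟩ := integral_le_of_affine_le hη hν H (l := l) (c := c) (g := φ) hintν
    (Eventually.of_forall fun y k => hle' k y) hcont.aestronglyMeasurable (fun y b hb => by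
      refine ⟨hle' 0 y, ?_⟩
      rw [← hsup, iSup_apply]
      exact ciSup_le hb)
  rw [extIntegral_eq_integral hintη, extIntegral_eq_integral hintν, EReal.coe_le_coe_iff]
  exact hfin

theorem ConvexOrder.integral_le_of_lipschitz (hη : IsP2 η) (hν : IsP2 ν) (h : ConvexOrder η ν)
    (φ : Euc d → ℝ) (hφ : ConvexOn ℝ Set.univ φ) (hL : ∃ L, LipschitzWith L φ) :
    ∫ x, φ x ∂η ≤ ∫ y, φ y ∂ν := by
  obtain ⟨L, hL⟩ := hL
  exact h.integral_le hφ (hη.integrable_of_lipschitzWith hL) (hν.integrable_of_lipschitzWith hL)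

/-- The convex order extends to the (possibly infinite) supremal convolution of an envelope. -/
theorem ConvexOrder.integral_supConv_le (hη : IsP2 η) (hν : IsP2 ν) (h : ConvexOrder η ν)
    {u : Euc d → ℝ} {q : Euc d → Euc d} (hu : IsEnvelope u q) (hmem : ∀ᵐ y ∂ν, y ∈ supDom u)
    (hint : Integrable (supConv u) ν) :
    (∀ᵐ y ∂η, y ∈ supDom u) ∧ Integrable (supConv u) η ∧
      ∫ y, supConv u y ∂η ≤ ∫ y, supConv u y ∂ν := by
  -- `supConv u` is meaningful only on `supDom u`, so the convex order is applied to maxima of its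
  -- affine minorants; by continuity in x, a dense sequence of base points recovers the supremum.
  set w := TopologicalSpace.denseSeq (Euc d)
  have hw := TopologicalSpace.denseRange_denseSeq (Euc d)
  set l : ℕ → Euc d →L[ℝ] ℝ := fun k => innerSL ℝ (q (w k))
  set c : ℕ → ℝ := fun k => u (w k) - inner ℝ (q (w k)) (w k - q (w k)) - ‖q (w k)‖ ^ 2 / 2
  have heq : ∀ k y, l k y + c k
      = u (w k) + inner ℝ (q (w k)) (y - (w k - q (w k))) - ‖q (w k)‖ ^ 2 / 2 := by
    intro k y
    simp only [l, c, innerSL_apply_apply]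
    rw [inner_sub_right _ y]
    ring
  have hall : ∀ y b, (∀ k, l k y + c k ≤ b) → ∀ x, u x - ‖x - y‖ ^ 2 / 2 ≤ b := by
    intro y b hb x
    have hcont : Continuous fun x => u x - ‖x - y‖ ^ 2 / 2 := by
      have := hu.continuous
      fun_prop
    refine hw.induction_on (p := fun x => u x - ‖x - y‖ ^ 2 / 2 ≤ b) x
      (isClosed_le hcont continuous_const) fun k => ?_
    have := hb k
    rw [heq] at this
    exact (IsEnvelope.sub_le_affine u q _ _).trans this
  have hle : ∀ y ∈ supDom u, ∀ k, l k y + c k ≤ supConv u y := by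
    intro y hy k
    rw [heq]
    exact hu.affine_le_of_forall_le (le_supConv_add hy) _
  obtain ⟨h1, h2⟩ := integral_le_of_affine_le hη hν (h.integral_le_of_lipschitz hη hν) hint
    (hmem.mono hle) (measurable_supConv u).aestronglyMeasurable (fun y b hb =>
      ⟨hle y (mem_supDom_of_forall_le (hall y b hb)) 0, supConv_le (hall y b hb)⟩)
  refine ⟨h1.mono fun y hy => ?_, h2⟩
  obtain ⟨b, hb⟩ := hy
  exact mem_supDom_of_forall_le (hall y b hb)

end Order

/-! ### Couplings -/

section Couplings

variable {d : ℕ} {μ ν : Measure (Euc d)} {π : Measure (Euc d × Euc d)}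

theorem integrable_fst_of_mem_couplings (hπ : π ∈ couplings μ ν) {f : Euc d → ℝ}
    (hf : Integrable f μ) : Integrable (fun p => f p.1) π :=
  Integrable.comp_measurable (hπ.2.1.symm ▸ hf) measurable_fst

theorem integrable_snd_of_mem_couplings (hπ : π ∈ couplings μ ν) {f : Euc d → ℝ}
    (hf : Integrable f ν) : Integrable (fun p => f p.2) π :=
  Integrable.comp_measurable (hπ.2.2.symm ▸ hf) measurable_snd

theorem integral_fst_of_mem_couplings (hπ : π ∈ couplings μ ν) {f : Euc d → ℝ}
    (hf : AEStronglyMeasurable f μ) : ∫ p, f p.1 ∂π = ∫ x, f x ∂μ := by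
  rw [← hπ.2.1] at hf ⊢
  exact (integral_map measurable_fst.aemeasurable hf).symm

theorem integral_snd_of_mem_couplings (hπ : π ∈ couplings μ ν) {f : Euc d → ℝ}
    (hf : AEStronglyMeasurable f ν) : ∫ p, f p.2 ∂π = ∫ y, f y ∂ν := by
  rw [← hπ.2.2] at hf ⊢
  exact (integral_map measurable_snd.aemeasurable hf).symm

theorem ae_snd_of_mem_couplings (hπ : π ∈ couplings μ ν) {P : Euc d → Prop}
    (h : ∀ᵐ y ∂ν, P y) : ∀ᵐ p ∂π, P p.2 :=
  ae_of_ae_map measurable_snd.aemeasurable (hπ.2.2.symm ▸ h)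

theorem integrable_sq_dist_of_mem_couplings (hμ : IsP2 μ) (hν : IsP2 ν)
    (hπ : π ∈ couplings μ ν) : Integrable (fun p => ‖p.1 - p.2‖ ^ 2) π := by
  have := hπ.1
  refine (((integrable_fst_of_mem_couplings hπ hμ.integrable_norm_sq).const_mul 2).add
    ((integrable_snd_of_mem_couplings hπ hν.integrable_norm_sq).const_mul 2)).mono'
    (by fun_prop) (Eventually.of_forall fun p => ?_)
  rw [Real.norm_of_nonneg (sq_nonneg _)]
  simp only [Pi.add_apply]
  nlinarith [norm_sub_le p.1 p.2, norm_nonneg (p.1 - p.2), sq_nonneg (‖p.1‖ - ‖p.2‖)]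

theorem lintegral_enorm_sq_eq {α : Type*} [MeasurableSpace α] {ρ : Measure α} {g : α → Euc d}
    (h : Integrable (fun a => ‖g a‖ ^ 2) ρ) :
    ∫⁻ a, ‖g a‖ₑ ^ 2 ∂ρ = ENNReal.ofReal (∫ a, ‖g a‖ ^ 2 ∂ρ) := by
  rw [ofReal_integral_eq_lintegral_ofReal h (Eventually.of_forall fun a => sq_nonneg _)]
  congr 1 with a
  rw [ENNReal.ofReal_pow (norm_nonneg _), ofReal_norm]

theorem isP2_map (hμ : IsP2 μ) {g : Euc d → Euc d} (hg : Measurable g)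
    (h : Integrable (fun x => ‖g x‖ ^ 2) μ) : IsP2 (μ.map g) := by
  have := hμ.1
  refine ⟨Measure.isProbabilityMeasure_map hg.aemeasurable, ?_⟩
  rw [lintegral_map (by fun_prop) hg, lintegral_enorm_sq_eq h]
  exact ENNReal.ofReal_lt_top

end Couplings

/-! ### Duality -/

namespace IsDualOptimal

variable {d : ℕ} {μ ν η ξ : Measure (Euc d)} {u : Euc d → ℝ} {q : Euc d → Euc d}
  {π : Measure (Euc d × Euc d)}

/-- Weak duality over the backward cone, with the deviation from the map `x ↦ x - q x`. -/
theorem backward_duality (hμ : IsP2 μ) (hν : IsP2 ν) (h : IsDualOptimal μ ν u q)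
    (hη : η ∈ backwardCone ν) (hπ : π ∈ couplings μ η) :
    Integrable (fun p => ‖p.2 - (p.1 - q p.1)‖ ^ 2) π ∧
    ∫ x, ‖q x‖ ^ 2 ∂μ + ∫ p, ‖p.2 - (p.1 - q p.1)‖ ^ 2 ∂π ≤ ∫ p, ‖p.1 - p.2‖ ^ 2 ∂π := by
  have henv := h.isEnvelope
  have hqc := henv.lipschitzWith.continuous
  obtain ⟨hdom, hint, hle⟩ := hη.2.integral_supConv_le hη.1 hν henv h.ae_mem h.integrable
  have hiu := hμ.integrable_of_isEnvelope henv
  have hiq := h.integrable_sq_gradient hμ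
  have hiD := integrable_sq_dist_of_mem_couplings hμ hη.1 hπ
  have hiq' := integrable_fst_of_mem_couplings hπ hiq
  have hiu' := integrable_fst_of_mem_couplings hπ hiu
  have hif' := integrable_snd_of_mem_couplings hπ hint
  have hiE : Integrable (fun p : Euc d × Euc d => ‖p.2 - (p.1 - q p.1)‖ ^ 2) π := by
    refine ((hiD.const_mul 2).add (hiq'.const_mul 2)).mono' ?_ (Eventually.of_forall fun p => ?_)
    · exact Continuous.aestronglyMeasurable (by fun_prop)
    · rw [Real.norm_of_nonneg (sq_nonneg _)]
      simp only [Pi.add_apply]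
      have e : p.2 - (p.1 - q p.1) = q p.1 - (p.1 - p.2) := by abel
      rw [e]
      nlinarith [norm_sub_le (q p.1) (p.1 - p.2), norm_nonneg (q p.1 - (p.1 - p.2)),
        sq_nonneg (‖p.1 - p.2‖ - ‖q p.1‖)]
  refine ⟨hiE, ?_⟩
  have h1 : ∫ p, (u p.1 + ‖p.2 - (p.1 - q p.1)‖ ^ 2 / 2) ∂π
      ≤ ∫ p, (supConv u p.2 + ‖p.1 - p.2‖ ^ 2 / 2) ∂π := by
    refine integral_mono_ae (hiu'.add (hiE.div_const 2)) (hif'.add (hiD.div_const 2)) ?_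
    filter_upwards [ae_snd_of_mem_couplings hπ hdom] with p hp using henv.add_sq_le hp p.1
  rw [integral_add hiu' (hiE.div_const 2), integral_add hif' (hiD.div_const 2), integral_div,
    integral_div, integral_fst_of_mem_couplings hπ hiu.aestronglyMeasurable,
    integral_snd_of_mem_couplings hπ hint.aestronglyMeasurable] at h1
  have h2 := h.integral_supConv_le hμ hν
  rw [integral_sub hiu (hiq.div_const 2), integral_div] at h2
  linarith

theorem integrable_sq_compl (hμ : IsP2 μ) (h : IsDualOptimal μ ν u q) :
    Integrable (fun x => ‖x - q x‖ ^ 2) μ := by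
  have hqc := h.isEnvelope.lipschitzWith.continuous
  refine ((hμ.integrable_norm_sq.const_mul 2).add
    ((h.integrable_sq_gradient hμ).const_mul 2)).mono'
    (Continuous.aestronglyMeasurable (by fun_prop)) (Eventually.of_forall fun x => ?_)
  rw [Real.norm_of_nonneg (sq_nonneg _)]
  simp only [Pi.add_apply]
  nlinarith [norm_sub_le x (q x), norm_nonneg (x - q x), sq_nonneg (‖x‖ - ‖q x‖)]

theorem map_compl_mem_backwardCone (hμ : IsP2 μ) (hν : IsP2 ν) (h : IsDualOptimal μ ν u q) :
    μ.map (fun x => x - q x) ∈ backwardCone ν := by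
  have hc := h.isEnvelope.lipschitzWith_compl.continuous
  have hP2 := isP2_map hμ hc.measurable (h.integrable_sq_compl hμ)
  refine ⟨hP2, convexOrder_of_lipschitz hP2 hν fun φ hφ ⟨L, hL⟩ => ?_⟩
  rw [integral_map hc.measurable.aemeasurable hL.continuous.aestronglyMeasurable]
  exact h.integral_comp_compl_le hμ hν hφ hL

/-! ### The forward cone: admissibility of the image measure and weak duality -/

section Forward

local notation "∇*" u => extGradient (legendre fun x => ‖x‖ ^ 2 / 2 - u x)

theorem forward_integrable (hμ : IsP2 μ) (hν : IsP2ac ν) (h : IsDualOptimal μ ν u q) :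
    Integrable (fun y => u ((∇* u) y)) ν ∧ ∫ y, u ((∇* u) y) ∂ν ≤ ∫ x, u x ∂μ := by
  obtain ⟨h1, h2⟩ := h.forward_variation hμ hν.1 hν.2 (convexOn_const (0 : ℝ) convex_univ)
    (LipschitzWith.const (0 : ℝ))
  simp only [zero_sub] at h1 h2
  rw [integral_neg, integral_neg, neg_le_neg_iff] at h2
  exact ⟨by simpa using h1.neg, h2⟩

/-- Equality in the constraint at the gradient writes half of this square as a difference of two
integrable functions. -/
theorem forward_integrable_sq (hμ : IsP2 μ) (hν : IsP2ac ν) (h : IsDualOptimal μ ν u q) :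
    Integrable (fun y => ‖(∇* u) y - y‖ ^ 2) ν := by
  have hcont := h.isEnvelope.continuous
  refine (((h.forward_integrable hμ hν).1.sub h.integrable).const_mul 2).congr ?_
  filter_upwards [ae_extDifferentiableAt hν.2 h.isEnvelope.convexOn h.ae_mem] with y hy
  have := supConv_eq_of_extDifferentiableAt hcont hy
  simp only [Pi.sub_apply]
  linarith

theorem integral_le_forward (hμ : IsP2 μ) (hν : IsP2ac ν) (h : IsDualOptimal μ ν u q)
    {ψ : Euc d → ℝ} (hψ : ConvexOn ℝ Set.univ ψ) {L : NNReal} (hL : LipschitzWith L ψ) :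
    ∫ x, ψ x ∂μ ≤ ∫ y, ψ ((∇* u) y) ∂ν := by
  have hiu := hμ.integrable_of_isEnvelope h.isEnvelope
  have hiX := (h.forward_integrable hμ hν).1
  refine le_of_forall_Ioc_le_add_mul
    (c := ∫ x, u x ∂μ - ∫ y, u ((∇* u) y) ∂ν) fun t ht => ?_
  have ht0 : 0 ≤ t⁻¹ := inv_nonneg.2 ht.1.le
  have hL' : LipschitzWith (‖t⁻¹‖₊ * L) fun x => t⁻¹ * ψ x :=
    (lipschitzWith_smul t⁻¹).comp hL
  obtain ⟨h1, h2⟩ := h.forward_variation hμ hν.1 hν.2 (hψ.smul ht0) hL'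
  simp only [smul_eq_mul] at h1 h2
  have h3 : Integrable (fun y => t⁻¹ * ψ ((∇* u) y)) ν := by
    refine (h1.add hiX).congr (Eventually.of_forall fun y => ?_)
    simp
  rw [integral_sub ((hμ.integrable_of_lipschitzWith hL).const_mul _) hiu,
    integral_sub h3 hiX, integral_const_mul, integral_const_mul] at h2
  have h4 := mul_le_mul_of_nonneg_left h2 ht.1.le
  rw [mul_sub, mul_sub, mul_inv_cancel_left₀ ht.1.ne', mul_inv_cancel_left₀ ht.1.ne'] at h4
  linarith

theorem map_extGradient_mem_forwardCone (hμ : IsP2 μ) (hν : IsP2ac ν)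
    (h : IsDualOptimal μ ν u q) : ν.map (∇* u) ∈ forwardCone μ := by
  have hm := measurable_extGradient (legendre fun x => ‖x‖ ^ 2 / 2 - u x)
  have hsq : Integrable (fun y => ‖(∇* u) y‖ ^ 2) ν := by
    refine (((h.forward_integrable_sq hμ hν).const_mul 2).add
      (hν.1.integrable_norm_sq.const_mul 2)).mono'
      (hm.norm.pow_const 2).aestronglyMeasurable (Eventually.of_forall fun y => ?_)
    rw [Real.norm_of_nonneg (sq_nonneg _)]
    simp only [Pi.add_apply]
    have := norm_add_le ((∇* u) y - y) y
    rw [sub_add_cancel] at this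
    nlinarith [norm_nonneg ((∇* u) y), sq_nonneg (‖(∇* u) y - y‖ - ‖y‖)]
  have hP2 := isP2_map hν.1 hm hsq
  refine ⟨hP2, convexOrder_of_lipschitz hμ hP2 fun ψ hψ ⟨L, hL⟩ => ?_⟩
  rw [integral_map hm.aemeasurable hL.continuous.aestronglyMeasurable]
  exact h.integral_le_forward hμ hν hψ hL

/-- Weak duality over the forward cone, with the Fenchel gap. -/
theorem forward_duality (hμ : IsP2 μ) (hν : IsP2ac ν) (h : IsDualOptimal μ ν u q)
    (hξ : ξ ∈ forwardCone μ) (hπ : π ∈ couplings ξ ν) :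
    Integrable (fun p => supConv u p.2 + ‖p.1 - p.2‖ ^ 2 / 2 - u p.1) π ∧
    ∫ y, ‖(∇* u) y - y‖ ^ 2 ∂ν + 2 * ∫ p, (supConv u p.2 + ‖p.1 - p.2‖ ^ 2 / 2 - u p.1) ∂π
      ≤ ∫ p, ‖p.1 - p.2‖ ^ 2 ∂π := by
  have henv := h.isEnvelope
  have hcont := henv.continuous
  have hiu := hξ.1.integrable_of_isEnvelope henv
  have hiu' := integrable_fst_of_mem_couplings hπ hiu
  have hif' := integrable_snd_of_mem_couplings hπ h.integrable
  have hiD := integrable_sq_dist_of_mem_couplings hξ.1 hν.1 hπ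
  have hiS : Integrable (fun p : Euc d × Euc d => supConv u p.2 + ‖p.1 - p.2‖ ^ 2 / 2) π :=
    hif'.add (hiD.div_const 2)
  refine ⟨hiS.sub hiu', ?_⟩
  rw [integral_sub hiS hiu', integral_add hif' (hiD.div_const 2), integral_div,
    integral_fst_of_mem_couplings hπ hiu.aestronglyMeasurable,
    integral_snd_of_mem_couplings hπ h.integrable.aestronglyMeasurable]
  -- Here the convex order is tested on u itself; chained with the ψ = 0 variation, it compares u
  -- under ξ with u along the optimal map.
  have h1 := hξ.2.integral_le henv.convexOn (hμ.integrable_of_isEnvelope henv) hiu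
  obtain ⟨h2, h3⟩ := h.forward_integrable hμ hν
  have h4 : ∫ y, u ((∇* u) y) ∂ν
      = ∫ y, supConv u y ∂ν + (∫ y, ‖(∇* u) y - y‖ ^ 2 ∂ν) / 2 := by
    rw [← integral_div, ← integral_add h.integrable ((h.forward_integrable_sq hμ hν).div_const 2)]
    refine integral_congr_ae ?_
    filter_upwards [ae_extDifferentiableAt hν.2 henv.convexOn h.ae_mem] with y hy
    exact supConv_eq_of_extDifferentiableAt hcont hy
  linarith

end Forward

end IsDualOptimal

/-! ### Uniqueness of the projections -/

theorem Complex.norm_exp_mul_I_sub_exp_mul_I_le (a b : ℝ) :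
    ‖Complex.exp (a * Complex.I) - Complex.exp (b * Complex.I)‖ ≤ |a - b| := by
  have e : Complex.exp (a * Complex.I) - Complex.exp (b * Complex.I)
      = Complex.exp (b * Complex.I) * (Complex.exp (Complex.I * ((a - b : ℝ) : ℂ)) - 1) := by
    rw [mul_sub, ← Complex.exp_add, mul_one]
    congr 2
    push_cast
    ring
  rw [e, norm_mul, Complex.norm_exp_ofReal_mul_I, one_mul]
  exact Real.norm_exp_I_mul_ofReal_sub_one_le

theorem Complex.norm_exp_mul_I_sub_exp_mul_I_le_two (a b : ℝ) :
    ‖Complex.exp (a * Complex.I) - Complex.exp (b * Complex.I)‖ ≤ 2 := by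
  refine (norm_sub_le _ _).trans ?_
  rw [Complex.norm_exp_ofReal_mul_I, Complex.norm_exp_ofReal_mul_I]
  norm_num

section Uniqueness

variable {d : ℕ}

/-- Two probability measures are equal if they admit realizations that are arbitrarily close. -/
theorem eq_of_forall_exists_realization {α : Type*} [MeasurableSpace α] {η ρ : Measure (Euc d)}
    [IsFiniteMeasure η] [IsFiniteMeasure ρ]
    (h : ∀ t : Euc d, ∀ δ > 0, ∃ (π : Measure α) (a b : α → Euc d) (k : α → ℝ),
      IsFiniteMeasure π ∧ Measurable a ∧ Measurable b ∧ π.map a = η ∧ π.map b = ρ ∧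
      Integrable k π ∧ ∫ p, k p ∂π ≤ δ ∧
      ∀ᵐ p ∂π, ‖Complex.exp (inner ℝ (a p) t * Complex.I)
        - Complex.exp (inner ℝ (b p) t * Complex.I)‖ ≤ k p) : η = ρ := by
  -- The realization may depend on the frequency t and on δ, so no optimal coupling has to exist.
  refine Measure.ext_of_charFun (funext fun t => ?_)
  rw [← sub_eq_zero, ← norm_le_zero_iff]
  refine le_of_forall_pos_le_add fun δ hδ => ?_
  rw [zero_add]
  obtain ⟨π, a, b, k, hπ, ha, hb, rfl, rfl, hk, hkδ, hle⟩ := h t δ hδ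
  have hcont : Continuous fun x : Euc d => Complex.exp ((inner ℝ x t : ℝ) * Complex.I) := by
    fun_prop
  have hint : ∀ {a : α → Euc d}, Measurable a →
      Integrable (fun p => Complex.exp ((inner ℝ (a p) t : ℝ) * Complex.I)) π := by
    intro a ha
    refine (integrable_const (1 : ℝ)).mono' (hcont.measurable.comp ha).aestronglyMeasurable
      (Eventually.of_forall fun p => ?_)
    rw [Complex.norm_exp_ofReal_mul_I]
  rw [charFun_apply, charFun_apply, integral_map ha.aemeasurable hcont.aestronglyMeasurable,
    integral_map hb.aemeasurable hcont.aestronglyMeasurable, ← integral_sub (hint ha) (hint hb)]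
  exact (norm_integral_le_of_norm_le hk hle).trans hkδ

theorem exists_coupling_lt {μ ν : Measure (Euc d)} {c : ℝ} (hμ : IsP2 μ) (hν : IsP2 ν)
    (h : transportCost μ ν < ENNReal.ofReal c) :
    ∃ π ∈ couplings μ ν, ∫ p, ‖p.1 - p.2‖ ^ 2 ∂π < c := by
  simp only [transportCost, iInf_lt_iff] at h
  obtain ⟨π, hπ, hlt⟩ := h
  rw [lintegral_enorm_sq_eq (integrable_sq_dist_of_mem_couplings hμ hν hπ)] at hlt
  exact ⟨π, hπ, (ENNReal.ofReal_lt_ofReal_iff_of_nonneg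
    (integral_nonneg fun p => sq_nonneg _)).1 hlt⟩

theorem transportCost_map_le (ρ : Measure (Euc d)) [IsProbabilityMeasure ρ] {a b : Euc d → Euc d}
    (ha : Measurable a) (hb : Measurable b) :
    transportCost (ρ.map a) (ρ.map b) ≤ ∫⁻ z, ‖a z - b z‖ₑ ^ 2 ∂ρ := by
  have hm : Measurable fun z => (a z, b z) := ha.prodMk hb
  have hmem : ρ.map (fun z => (a z, b z)) ∈ couplings (ρ.map a) (ρ.map b) := by
    refine ⟨Measure.isProbabilityMeasure_map hm.aemeasurable, ?_, ?_⟩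
    · rw [Measure.map_map measurable_fst hm]
      rfl
    · rw [Measure.map_map measurable_snd hm]
      rfl
  refine (iInf₂_le _ hmem).trans (le_of_eq ?_)
  rw [lintegral_map (by fun_prop) hm]

variable {μ ν η ξ : Measure (Euc d)} {u : Euc d → ℝ} {q : Euc d → Euc d}

/-! ### Optimal values, and uniqueness of the backward projection -/

namespace IsDualOptimal

theorem le_transportCost_backward (hμ : IsP2 μ) (hν : IsP2 ν) (h : IsDualOptimal μ ν u q)
    (hη : η ∈ backwardCone ν) : ∫⁻ x, ‖q x‖ₑ ^ 2 ∂μ ≤ transportCost μ η := by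
  refine le_iInf₂ fun π hπ => ?_
  obtain ⟨-, h1⟩ := h.backward_duality hμ hν hη hπ
  rw [lintegral_enorm_sq_eq (h.integrable_sq_gradient hμ),
    lintegral_enorm_sq_eq (integrable_sq_dist_of_mem_couplings hμ hη.1 hπ)]
  refine ENNReal.ofReal_le_ofReal ?_
  have : 0 ≤ ∫ p, ‖p.2 - (p.1 - q p.1)‖ ^ 2 ∂π := integral_nonneg fun p => sq_nonneg _
  linarith

theorem transportCost_backward (hμ : IsP2 μ) (hν : IsP2 ν) (h : IsDualOptimal μ ν u q) :
    transportCost μ (μ.map fun x => x - q x) = ∫⁻ x, ‖q x‖ₑ ^ 2 ∂μ := by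
  have := hμ.1
  have hm := h.isEnvelope.lipschitzWith_compl.continuous.measurable
  refine le_antisymm ?_ (h.le_transportCost_backward hμ hν (h.map_compl_mem_backwardCone hμ hν))
  simpa using transportCost_map_le μ measurable_id hm

/-- A coupling whose cost exceeds the minimum by less than s² has its second coordinate within mean
square s² of x - q x, by `backward_duality`. -/
theorem eq_of_transportCost_backward (hμ : IsP2 μ) (hν : IsP2 ν) (h : IsDualOptimal μ ν u q)
    (hη : η ∈ backwardCone ν) (hc : transportCost μ η = ∫⁻ x, ‖q x‖ₑ ^ 2 ∂μ) :
    η = μ.map fun x => x - q x := by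
  have := hη.1.1
  have := hμ.1
  have hm := h.isEnvelope.lipschitzWith_compl.continuous.measurable
  have := (h.map_compl_mem_backwardCone hμ hν).1.1
  refine eq_of_forall_exists_realization (α := Euc d × Euc d) fun t δ hδ => ?_
  obtain ⟨s, hs, hsδ⟩ : ∃ s > 0, (‖t‖ + 1) * (s + s) = δ :=
    ⟨δ / (2 * (‖t‖ + 1)), by positivity, by field_simp; ring⟩
  set C := ∫ x, ‖q x‖ ^ 2 ∂μ
  have hC : 0 ≤ C := integral_nonneg fun x => sq_nonneg _
  rw [lintegral_enorm_sq_eq (h.integrable_sq_gradient hμ)] at hc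
  obtain ⟨π, hπ, hlt⟩ := exists_coupling_lt hμ hη.1 (c := C + s ^ 2) (by
    rw [hc]
    exact (ENNReal.ofReal_lt_ofReal_iff_of_nonneg hC).2 (by linarith [pow_pos hs 2]))
  obtain ⟨hint, hle⟩ := h.backward_duality hμ hν hη hπ
  have := hπ.1
  have hik : Integrable (fun p : Euc d × Euc d => s + ‖p.2 - (p.1 - q p.1)‖ ^ 2 / s) π :=
    (integrable_const s).add (hint.div_const s)
  refine ⟨π, Prod.snd, fun p => p.1 - q p.1,
    fun p => (‖t‖ + 1) * (s + ‖p.2 - (p.1 - q p.1)‖ ^ 2 / s), inferInstance, measurable_snd,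
    hm.comp measurable_fst, hπ.2.2, ?_, hik.const_mul _, ?_, Eventually.of_forall fun p => ?_⟩
  · rw [← hπ.2.1, Measure.map_map hm measurable_fst]
    rfl
  · rw [integral_const_mul, integral_add (integrable_const s) (hint.div_const s), integral_div,
      integral_const, probReal_univ, one_smul]
    have h1 : (∫ p, ‖p.2 - (p.1 - q p.1)‖ ^ 2 ∂π) / s ≤ s := by
      rw [div_le_iff₀ hs]
      nlinarith
    calc (‖t‖ + 1) * (s + (∫ p, ‖p.2 - (p.1 - q p.1)‖ ^ 2 ∂π) / s)
        ≤ (‖t‖ + 1) * (s + s) := by gcongr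
      _ = δ := hsδ
  · refine (Complex.norm_exp_mul_I_sub_exp_mul_I_le _ _).trans ?_
    rw [← inner_sub_left]
    refine (abs_real_inner_le_norm _ _).trans ?_
    set r := ‖p.2 - (p.1 - q p.1)‖
    -- Stands in for the Cauchy–Schwarz inequality in passing from the second moment of r to its
    -- mean.
    have hr : r ≤ s + r ^ 2 / s := by
      have : r * s ≤ s * s + r ^ 2 := by nlinarith [sq_nonneg (r - s), sq_nonneg r, sq_nonneg s]
      have h2 : s + r ^ 2 / s = (s * s + r ^ 2) / s := by field_simp
      rw [h2, le_div_iff₀ hs]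
      exact this
    have hr0 : 0 ≤ r := norm_nonneg _
    rw [mul_comm]
    nlinarith [norm_nonneg t]

section Forward

local notation "∇*" u => extGradient (legendre fun x => ‖x‖ ^ 2 / 2 - u x)

theorem le_transportCost_forward (hμ : IsP2 μ) (hν : IsP2ac ν) (h : IsDualOptimal μ ν u q)
    (hξ : ξ ∈ forwardCone μ) : ∫⁻ y, ‖(∇* u) y - y‖ₑ ^ 2 ∂ν ≤ transportCost ξ ν := by
  refine le_iInf₂ fun π hπ => ?_
  obtain ⟨-, h1⟩ := h.forward_duality hμ hν hξ hπ
  rw [lintegral_enorm_sq_eq (h.forward_integrable_sq hμ hν),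
    lintegral_enorm_sq_eq (integrable_sq_dist_of_mem_couplings hξ.1 hν.1 hπ)]
  refine ENNReal.ofReal_le_ofReal ?_
  have : 0 ≤ ∫ p, (supConv u p.2 + ‖p.1 - p.2‖ ^ 2 / 2 - u p.1) ∂π := by
    refine integral_nonneg_of_ae ?_
    filter_upwards [ae_snd_of_mem_couplings hπ h.ae_mem] with p hp
    exact sub_nonneg.2 (le_supConv_add hp p.1)
  linarith

theorem transportCost_forward (hμ : IsP2 μ) (hν : IsP2ac ν) (h : IsDualOptimal μ ν u q) :
    transportCost (ν.map (∇* u)) ν = ∫⁻ y, ‖(∇* u) y - y‖ₑ ^ 2 ∂ν := by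
  have := hν.1.1
  have hm := measurable_extGradient (legendre fun x => ‖x‖ ^ 2 / 2 - u x)
  refine le_antisymm ?_ (h.le_transportCost_forward hμ hν
    (h.map_extGradient_mem_forwardCone hμ hν))
  simpa using transportCost_map_le ν hm measurable_id

end Forward

end IsDualOptimal

/-! ### Uniqueness of the forward projection -/

/-- The truncated first-order remainder of `Φ*` in the directions `± s t`. -/
noncomputable def truncRemainder (Φ : Euc d → ℝ) (t : Euc d) (s : ℝ) (y : Euc d) : ℝ :=
  open scoped Classical in
  -- The cap 2 is the trivial bound on the difference of two unit complex numbers; it also serves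
  -- where Φ* is infinite and makes dominated convergence available.
  if legendre Φ (y + s • t) ≠ ⊤ ∧ legendre Φ (y + (-s) • t) ≠ ⊤ then
    min 2 ((|(legendre Φ (y + s • t)).toReal - (legendre Φ y).toReal
        - inner ℝ (extGradient (legendre Φ) y) (s • t)|
      + |(legendre Φ (y + (-s) • t)).toReal - (legendre Φ y).toReal
        - inner ℝ (extGradient (legendre Φ) y) ((-s) • t)|) / s)
  else 2

theorem measurable_truncRemainder (Φ : Euc d → ℝ) (t : Euc d) (s : ℝ) :
    Measurable (truncRemainder Φ t s) := by
  have h1 := measurable_legendre Φ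
  have h2 := measurable_extGradient (legendre Φ)
  have h3 : ∀ c : ℝ, Measurable fun y : Euc d => legendre Φ (y + c • t) := fun c =>
    h1.comp (measurable_id.add_const _)
  have h4 : ∀ c : ℝ, Measurable fun y : Euc d => inner ℝ (extGradient (legendre Φ) y) (c • t) :=
    fun c => h2.inner_const
  have h5 : ∀ c : ℝ, Measurable fun y : Euc d => |(legendre Φ (y + c • t)).toReal
      - (legendre Φ y).toReal - inner ℝ (extGradient (legendre Φ) y) (c • t)| := fun c =>
    (((h3 c).ereal_toReal.sub h1.ereal_toReal).sub (h4 c)).abs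
  refine Measurable.ite ?_ ?_ measurable_const
  · exact ((h3 s) (measurableSet_singleton ⊤).compl).inter
      ((h3 (-s)) (measurableSet_singleton ⊤).compl)
  · exact measurable_const.min (((h5 s).add (h5 (-s))).div_const s)

theorem truncRemainder_nonneg (Φ : Euc d → ℝ) (t : Euc d) {s : ℝ} (hs : 0 < s) (y : Euc d) :
    0 ≤ truncRemainder Φ t s y := by
  rw [truncRemainder]
  split_ifs
  · positivity
  · norm_num

theorem truncRemainder_le (Φ : Euc d → ℝ) (t : Euc d) (s : ℝ) (y : Euc d) :
    truncRemainder Φ t s y ≤ 2 := by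
  rw [truncRemainder]
  split_ifs
  · exact min_le_left _ _
  · exact le_rfl

theorem tendsto_truncRemainder {Φ : Euc d → ℝ} {y : Euc d}
    (hy : ExtDifferentiableAt (legendre Φ) y) (t : Euc d) {s : ℕ → ℝ} (hs : ∀ n, 0 < s n)
    (hlim : Tendsto s atTop (𝓝 0)) :
    Tendsto (fun n => truncRemainder Φ t (s n) y) atTop (𝓝 0) := by
  have hpt : ∀ c : ℝ, Tendsto (fun n => y + (c * s n) • t) atTop (𝓝 y) := by
    intro c
    have := ((hlim.const_mul c).smul_const t).const_add y
    simpa using this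
  rw [Metric.tendsto_atTop']
  intro ε hε
  set κ := ε / (4 * (‖t‖ + 1))
  have hκ : 0 < κ := by positivity
  have hev := ((hasGradientAt_iff_isLittleO.1 hy.hasGradientAt).bound hκ).and hy.1
  obtain ⟨N, hN⟩ := eventually_atTop.1 (((hpt 1).eventually hev).and ((hpt (-1)).eventually hev))
  refine ⟨N, fun n hn => ?_⟩
  obtain ⟨⟨h1, h2, -⟩, h3, h4, -⟩ := hN n hn.le
  rw [add_sub_cancel_left, one_mul, norm_smul, Real.norm_eq_abs, Real.norm_eq_abs,
    abs_of_pos (hs n)] at h1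
  rw [add_sub_cancel_left, neg_one_mul, norm_smul, Real.norm_eq_abs, Real.norm_eq_abs, abs_neg,
    abs_of_pos (hs n)] at h3
  rw [one_mul] at h2
  rw [neg_one_mul] at h4
  rw [Real.dist_eq, sub_zero, abs_of_nonneg (truncRemainder_nonneg Φ t (hs n) y), truncRemainder,
    if_pos ⟨h2, h4⟩]
  refine (min_le_right _ _).trans_lt ?_
  rw [div_lt_iff₀ (hs n)]
  have h5 : κ * (s n * ‖t‖) + κ * (s n * ‖t‖) < ε * s n := by
    have : κ * ‖t‖ < ε / 2 := by
      have e : κ * (4 * (‖t‖ + 1)) = ε := div_mul_cancel₀ _ (by positivity)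
      nlinarith [norm_nonneg t]
    nlinarith [hs n]
  linarith

/-- Fenchel's inequality at y + s t and at y - s t bounds both signs of s⟨x - a, t⟩, with a the
gradient, by the gap plus a remainder; dividing by s bounds the phase difference. -/
theorem norm_exp_sub_exp_le_truncRemainder {Φ : Euc d → ℝ} {y : Euc d}
    (hy : legendre Φ y ≠ ⊤) (x t : Euc d) {s : ℝ} (hs : 0 < s) :
    ‖Complex.exp (inner ℝ x t * Complex.I)
        - Complex.exp (inner ℝ (extGradient (legendre Φ) y) t * Complex.I)‖
      ≤ ((legendre Φ y).toReal + Φ x - inner ℝ x y) / s + truncRemainder Φ t s y := by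
  have hgap : 0 ≤ ((legendre Φ y).toReal + Φ x - inner ℝ x y) / s := by
    have := inner_sub_le_toReal_legendre hy x
    exact div_nonneg (by linarith) hs.le
  have htwo := Complex.norm_exp_mul_I_sub_exp_mul_I_le_two (inner ℝ x t)
    (inner ℝ (extGradient (legendre Φ) y) t)
  rw [truncRemainder]
  split_ifs with hdom
  · have habs := Complex.norm_exp_mul_I_sub_exp_mul_I_le (inner ℝ x t)
      (inner ℝ (extGradient (legendre Φ) y) t)
    rw [← inner_sub_left] at habs
    set a := extGradient (legendre Φ) y
    have h1 := inner_le_gap_add hdom.1 x a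
    have h2 := inner_le_gap_add hdom.2 x a
    set r₁ := (legendre Φ (y + s • t)).toReal - (legendre Φ y).toReal - inner ℝ a (s • t)
    set r₂ := (legendre Φ (y + (-s) • t)).toReal - (legendre Φ y).toReal - inner ℝ a ((-s) • t)
    set g := (legendre Φ y).toReal + Φ x - inner ℝ x y
    rw [real_inner_smul_right] at h1 h2
    have h3 : |inner ℝ (x - a) t| ≤ g / s + (|r₁| + |r₂|) / s := by
      rw [← add_div, le_div_iff₀ hs]
      rcases abs_cases (inner ℝ (x - a) t) with h | h <;> rw [h.1] <;>
        nlinarith [le_abs_self r₁, le_abs_self r₂, abs_nonneg r₁, abs_nonneg r₂]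
    rw [← sub_le_iff_le_add']
    exact le_min (by linarith) (by linarith)
  · linarith

section Forward

local notation "∇*" u => extGradient (legendre fun x => ‖x‖ ^ 2 / 2 - u x)

/-- Only the Fenchel gap is available here, and how strongly it controls the distance depends on y.
Therefore s is fixed first, by dominated convergence, to make the mean remainder small; the coupling
is chosen afterwards. -/
theorem IsDualOptimal.eq_of_transportCost_forward (hμ : IsP2 μ) (hν : IsP2ac ν)
    (h : IsDualOptimal μ ν u q) (hξ : ξ ∈ forwardCone μ)
    (hc : transportCost ξ ν = ∫⁻ y, ‖(∇* u) y - y‖ₑ ^ 2 ∂ν) : ξ = ν.map (∇* u) := by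
  have := hξ.1.1
  have := hν.1.1
  have := (h.map_extGradient_mem_forwardCone hμ hν).1.1
  have hm := measurable_extGradient (legendre fun x => ‖x‖ ^ 2 / 2 - u x)
  refine eq_of_forall_exists_realization (α := Euc d × Euc d) fun t δ hδ => ?_
  set Φ : Euc d → ℝ := fun x => ‖x‖ ^ 2 / 2 - u x
  have hrem : ∀ s : ℝ, 0 < s → Integrable (truncRemainder Φ t s) ν := fun s hs =>
    (integrable_const (2 : ℝ)).mono' (measurable_truncRemainder Φ t s).aestronglyMeasurable
      (Eventually.of_forall fun y => by
        rw [Real.norm_of_nonneg (truncRemainder_nonneg Φ t hs y)]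
        exact truncRemainder_le Φ t s y)
  obtain ⟨s, hs, hsδ⟩ : ∃ s > 0, ∫ y, truncRemainder Φ t s y ∂ν ≤ δ / 2 := by
    have hpos : ∀ n : ℕ, 0 < 1 / ((n : ℝ) + 1) := fun n => Nat.one_div_pos_of_nat
    have hlim : Tendsto (fun n : ℕ => ∫ y, truncRemainder Φ t (1 / ((n : ℝ) + 1)) y ∂ν) atTop
        (𝓝 (∫ _, (0 : ℝ) ∂ν)) := by
      refine tendsto_integral_of_dominated_convergence (fun _ => 2)
        (fun n => (hrem _ (hpos n)).aestronglyMeasurable) (integrable_const _) (fun n => ?_) ?_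
      · refine Eventually.of_forall fun y => ?_
        rw [Real.norm_of_nonneg (truncRemainder_nonneg Φ t (hpos n) y)]
        exact truncRemainder_le Φ t _ y
      · filter_upwards [ae_extDifferentiableAt hν.2 h.isEnvelope.convexOn h.ae_mem] with y hy
        exact tendsto_truncRemainder hy t hpos tendsto_one_div_add_atTop_nhds_zero_nat
    rw [integral_zero] at hlim
    obtain ⟨n, hn⟩ := (hlim.eventually (gt_mem_nhds (half_pos hδ))).exists
    exact ⟨_, hpos n, hn.le⟩
  set C := ∫ y, ‖(∇* u) y - y‖ ^ 2 ∂ν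
  have hC : 0 ≤ C := integral_nonneg fun x => sq_nonneg _
  rw [lintegral_enorm_sq_eq (h.forward_integrable_sq hμ hν)] at hc
  -- An excess below δs leaves a mean gap of at most δs/2, that is δ/2 after division by s.
  obtain ⟨π, hπ, hlt⟩ := exists_coupling_lt hξ.1 hν.1 (c := C + δ * s) (by
    rw [hc]
    exact (ENNReal.ofReal_lt_ofReal_iff_of_nonneg hC).2 (by linarith [mul_pos hδ hs]))
  obtain ⟨hint, hle⟩ := h.forward_duality hμ hν hξ hπ
  have := hπ.1
  have hir := integrable_snd_of_mem_couplings hπ (hrem s hs)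
  refine ⟨π, Prod.fst, fun p => (∇* u) p.2,
    fun p => (supConv u p.2 + ‖p.1 - p.2‖ ^ 2 / 2 - u p.1) / s + truncRemainder Φ t s p.2,
    inferInstance, measurable_fst, hm.comp measurable_snd, hπ.2.1, ?_,
    (hint.div_const s).add hir, ?_, ?_⟩
  · rw [← hπ.2.2, Measure.map_map hm measurable_snd]
    rfl
  · rw [integral_add (hint.div_const s) hir, integral_div,
      integral_snd_of_mem_couplings hπ (hrem s hs).aestronglyMeasurable]
    have : (∫ p, (supConv u p.2 + ‖p.1 - p.2‖ ^ 2 / 2 - u p.1) ∂π) / s ≤ δ / 2 := by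
      rw [div_le_iff₀ hs]
      linarith
    linarith
  · filter_upwards [ae_snd_of_mem_couplings hπ h.ae_mem] with p hp
    rw [← gap_eq]
    exact norm_exp_sub_exp_le_truncRemainder (Φ := Φ) hp p.1 t hs

end Forward

end Uniqueness

/-! ### The main theorem -/

/-- Lebesgue measure has the same null sets as d-dimensional Hausdorff measure, which a Lipschitz
map enlarges by at most a constant factor. -/
theorem volume_image_eq_zero_of_lipschitzWith {d : ℕ} {f : Euc d → Euc d} {K : NNReal}
    (hf : LipschitzWith K f) {s : Set (Euc d)} (hs : volume s = 0) : volume (f '' s) = 0 := by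
  have hac₁ : (volume : Measure (Euc d)) ≪ μH[Module.finrank ℝ (Euc d)] :=
    Measure.absolutelyContinuous_isAddHaarMeasure _ _
  have hac₂ : (μH[Module.finrank ℝ (Euc d)] : Measure (Euc d)) ≪ volume :=
    Measure.absolutelyContinuous_isAddHaarMeasure _ _
  refine hac₁ (le_antisymm ((hf.hausdorffMeasure_image_le (Nat.cast_nonneg _) s).trans ?_)
    zero_le)
  rw [hac₂ hs, mul_zero]

/-- Either side amounts to equality in Fenchel's inequality at (x, y), that is, to y being a
subgradient of Φ at x. -/
theorem IsEnvelope.extGradient_eq_iff {d : ℕ} {u : Euc d → ℝ} {q : Euc d → Euc d}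
    (h : IsEnvelope u q) {x y : Euc d}
    (hy : ExtDifferentiableAt (legendre fun x => ‖x‖ ^ 2 / 2 - u x) y) :
    extGradient (legendre fun x => ‖x‖ ^ 2 / 2 - u x) y = x ↔ x - q x = y := by
  constructor
  · rintro rfl
    refine h.eq_of_compl_lower fun w => ?_
    have hcont := h.continuous
    have h1 := hy.toReal_legendre_eq (by fun_prop)
    have h2 := inner_sub_le_toReal_legendre hy.ne_top w
    rw [inner_sub_right, real_inner_comm w y, real_inner_comm _ y]
    linarith
  · rintro rfl
    refine hy.eq_extGradient fun w => ?_
    have h1 := h.compl_lower x w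
    rw [inner_sub_right, real_inner_comm w, real_inner_comm x] at h1
    linarith

theorem mainTheorem7 {d : ℕ} (μ ν : Measure (Euc d)) (hμ : IsP2 μ) (hν : IsP2ac ν) :
    ∃ μbar νbar : Measure (Euc d),
      -- the projections exist and are unique
      (∀ η, IsBackwardProjection μ ν η ↔ η = μbar) ∧
      (∀ ξ, IsForwardProjection μ ν ξ ↔ ξ = νbar) ∧
      (∃ Φ : Euc d → ℝ, ConvexOn ℝ Set.univ Φ ∧ ContDiff ℝ 1 Φ ∧
        μ.map (∇ Φ) = μbar ∧
        (∀ᵐ y ∂ν, ExtDifferentiableAt (legendre Φ) y) ∧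
        ν.map (extGradient (legendre Φ)) = νbar ∧
        -- both gradients are optimal transport maps
        ∫⁻ x, ‖x - ∇ Φ x‖ₑ ^ 2 ∂μ = transportCost μ μbar ∧
        ∫⁻ y, ‖extGradient (legendre Φ) y - y‖ₑ ^ 2 ∂ν = transportCost νbar ν ∧
        -- they are inverse to each other
        (∀ x y : Euc d, ExtDifferentiableAt (legendre Φ) y →
          (extGradient (legendre Φ) y = x ↔ ∇ Φ x = y)) ∧
        (∀ᵐ y ∂ν, ∇ Φ (extGradient (legendre Φ) y) = y) ∧
        (∀ᵐ x ∂νbar, extGradient (legendre Φ) (∇ Φ x) = x)) ∧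
      IsP2ac νbar := by
  obtain ⟨u, q, hu, hmem, hint, hopt⟩ := exists_dual_optimizer hμ hν.1
  have h : IsDualOptimal μ ν u q := ⟨hu, hmem, hint, hopt⟩
  have hdiff := ae_extDifferentiableAt hν.2 hu.convexOn hmem
  have hm := measurable_extGradient (legendre fun x => ‖x‖ ^ 2 / 2 - u x)
  have hpm : Measurable fun x => x - q x := hu.lipschitzWith_compl.continuous.measurable
  have hB := h.map_compl_mem_backwardCone hμ hν.1
  have hF := h.map_extGradient_mem_forwardCone hμ hν
  have hBval := h.transportCost_backward hμ hν.1
  have hFval := h.transportCost_forward hμ hν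
  have hBinf : ⨅ η' ∈ backwardCone ν, transportCost μ η' = ∫⁻ x, ‖q x‖ₑ ^ 2 ∂μ :=
    le_antisymm ((iInf₂_le _ hB).trans hBval.le)
      (le_iInf₂ fun η hη => h.le_transportCost_backward hμ hν.1 hη)
  have hFinf : ⨅ ξ' ∈ forwardCone μ, transportCost ξ' ν
      = ∫⁻ y, ‖extGradient (legendre fun x => ‖x‖ ^ 2 / 2 - u x) y - y‖ₑ ^ 2 ∂ν :=
    le_antisymm ((iInf₂_le _ hF).trans hFval.le)
      (le_iInf₂ fun ξ hξ => h.le_transportCost_forward hμ hν hξ)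
  have hinv : ∀ᵐ y ∂ν, (fun x => x - q x)
      (extGradient (legendre fun x => ‖x‖ ^ 2 / 2 - u x) y) = y := by
    filter_upwards [hdiff] with y hy
    exact (hu.extGradient_eq_iff hy).1 rfl
  refine ⟨μ.map fun x => x - q x, ν.map (extGradient (legendre fun x => ‖x‖ ^ 2 / 2 - u x)),
    fun η => ⟨fun hη => ?_, ?_⟩, fun ξ => ⟨fun hξ => ?_, ?_⟩,
    ⟨fun x => ‖x‖ ^ 2 / 2 - u x, hu.compl_convexOn, hu.contDiff, ?_⟩, hF.1, ?_⟩
  · exact h.eq_of_transportCost_backward hμ hν.1 hη.1 (hη.2.trans hBinf)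
  · rintro rfl
    exact ⟨hB, hBval.trans hBinf.symm⟩
  · exact h.eq_of_transportCost_forward hμ hν hξ.1 (hξ.2.trans hFinf)
  · rintro rfl
    exact ⟨hF, hFval.trans hFinf.symm⟩
  · rw [hu.gradient_eq]
    refine ⟨rfl, hdiff, rfl, ?_, hFval.symm, fun x y hy => hu.extGradient_eq_iff hy, hinv, ?_⟩
    · rw [hBval]
      simp
    · refine (ae_map_iff hm.aemeasurable
        (measurableSet_eq_fun (hm.comp hpm) measurable_id)).2 ?_
      filter_upwards [hinv] with y hy
      exact congrArg _ hy
  · refine Measure.AbsolutelyContinuous.mk fun s hs hs0 => ?_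
    rw [Measure.map_apply hm hs]
    -- Up to a ν-null set, the preimage of s under ∇Φ* lies in ∇Φ(s), which is Lebesgue null because
    -- ∇Φ is Lipschitz.
    refine measure_mono_null_ae ?_ (hν.2
      (volume_image_eq_zero_of_lipschitzWith hu.lipschitzWith_compl hs0))
    filter_upwards [hinv] with y hy hys
    exact ⟨_, hys, hy⟩
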